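/- **Setting.** A *PCM* $U$ is a partial commutative monoid with join $\bullet$, unit $1$ and a predicate "defined" (the unit is defined; if $x\bullet y$ is defined, so is $x$). A *state* of type $(U,T)$ is a triple $s=(a_s,a_j,a_o)\in U\times T\times U$; put $s^\top=(a_o,a_j,a_s)$, $s\lhd p=(a_s\bullet p,a_j,a_o)$, $s\rhd p=(a_s,a_j,p\bullet a_o)$. A *state space* is a predicate $S$ on states such that $S(s)$ implies that $a_s(s)\bullet a_o(s)$ is defined, and $S(s\lhd p)\Leftrightarrow S(s\rhd p)$. A *flattening* maps states of $S$ to defined heaps and takes equal values at $s\lhd p$ and $s\rhd p$. A *transition* over $S$ is a binary relation $t$ on states that is functional ($t\,s\,s_1$ and $t\,s\,s_2$ imply $s_1=s_2$), other-fixing ($t\,s\,s'$ implies $a_o(s)=a_o(s')$), local (if $t\,(s\rhd p)\,s'$ then $s'=s''\rhd p$ and $t\,(s\lhd p)\,(s''\lhd p)$ for some $s''$) and $S$-preserving; it is *internal* if it preserves the set of pointers of the flattened heap. A *resource* $V=(U,T,S,\Delta_i,\Delta_e)$ consists of a state space with flattening, a set $\Delta_i$ of internal transitions and a set $\Delta_e$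 of (external) transitions. Write $s\to_o s'$ if $t\,s^\top s'^\top$ for some $t\in\Delta_i\cup\Delta_e$, and $\to_o^*$ for the reflexive-transitive closure; $\overline P\,s:\Leftrightarrow\forall s'.\ s\to_o^*s'\Rightarrow P\,s'$; and $(P*Q)\,s$ holds iff $a_s(s)=x_1\bullet x_2$ with $P(x_1,a_j(s),a_o(s)\bullet x_2)$ and $Q(x_2,a_j(s),a_o(s)\bullet x_1)$ for some $x_1,x_2$. An *action* over $V$ of type $A$ is a relation $a\,v\,s\,s'$ such that $a\,v\in\Delta_i$ for every $v:A$ and $s$ determines $v$. An *indexed family of morphisms* $f:V\to_X W$ consists of relations $f\,x$ ($x\in X$) between states in $S_V$ and states in $S_W$, and maps $f\,x:V.\Delta_i\to W.\Delta_i$, such that: (1) if $t\in V.\Delta_i$, $t\,s_v\,s_v'$ and $(s_v,s_w)\in f\,x$, then $f\,x\,t\,s_w\,s_w'$ and $(s_v',s_w')\in f\,x'$ for some $x',s_w'$; (2) if $s_w\to_o^*s_w'$ and $(s_v,s_w)\in f\,x$, then $s_v\to_o^*s_v'$ and $(s_v',s_w')\in f\,x$ for some $s_v'$; (3) $(s_{v1},s_w),(s_{v2},s_w)\in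 f\,x$ imply $s_{v1}=s_{v2}$; (4) there is $\phi:U_W\to U_V$ such that $(s_v,s_w\rhd p)\in f\,x$ implies $s_v=s_v'\rhd\phi p$ and $(s_v'\lhd\phi p,s_w\lhd p)\in f\,x$ for some $s_v'$; (5) $(s_v,s_w)\in f\,x$, $(s_v',s_w')\in f\,x'$ and $a_o(s_w)=a_o(s_w')$ imply $a_o(s_v)=a_o(s_v')$; (6) $(s_v,s_{w1})\in f\,x_1$ and $(s_v,s_{w2})\in f\,x_2$ imply $x_1=x_2$. A *morphism* $f:V\to W$ is the same without indices. Put $\langle f\,x\rangle P=\lambda s_w.\,\exists s_v.\,(s_v,s_w)\in f\,x\wedge P\,s_v$. The pair $x,s_w$ *$f$-steps* to $x',s_w'$ if either there are $t\in V.\Delta_i$ and $(s_v,s_w)\in f\,x$, $(s_v',s_w')\in f\,x'$ with $t\,s_v\,s_v'$ and $f\,x\,t\,s_w\,s_w'$, or $x'=x$ and $s_w\to_o s_w'$. The $f$-stabilization $\overline{I}^{f}\,x\,s$ says that $I$ holds at all pairs reachable from $x,s$ by finitely many $f$-steps; $I$ is *$f$-stable* if $I\,x\,s\Rightarrow \overline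 I^f x\,s$. For morphisms, drop the indices. *Action trees* $T:\mathsf{tree}\,V\,A$ are generated by $\mathsf{Unfinished}$, $\mathsf{Ret}\,v$, $\mathsf{Act}\,a$, $\mathsf{Seq}\,T\,K$ ($T:\mathsf{tree}\,V\,B$, $K:B\to\mathsf{tree}\,V\,A$), $\mathsf{Par}\,T_1\,T_2\,K$ ($K:B_1\times B_2\to\mathsf{tree}\,V\,A$), and $\mathsf{Morph}\,x\,f\,T$ ($f:W\to_X V$, $T:\mathsf{tree}\,W\,A$). *Programs*: $\mathsf{ST}\,V\,A=\{e\subseteq\mathsf{tree}\,V\,A\mid\mathsf{Unfinished}\in e\}$, with $\mathsf{ret}\,r=\{\mathsf{Unfinished},\mathsf{Ret}\,r\}$, $\mathsf{atomic}\,a=\{\mathsf{Unfinished},\mathsf{Act}\,a\}$, and, adding $\mathsf{Unfinished}$ each time, $(x\leftarrow e_1;e_2\,x)=\{\mathsf{Seq}\,T\,K\mid T\in e_1,\forall x.\,K\,x\in e_2\,x\}$, $e_1\parallel e_2=\{\mathsf{Par}\,T_1\,T_2\,\mathsf{Ret}\mid T_i\in e_i\}$, $\mathsf{morph}\,x\,f\,e=\{\mathsf{Morph}\,x\,f\,T\mid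 T\in e\}$; for a morphism $f$, $\mathsf{morph}\,f\,e$ is the case of a one-element index type. A *context* $\Delta:V\to W$ is a composable sequence $f_0,\dots,f_n$ of families (outermost first), with index tuples $\bar x$; $\Delta(\bar x)(t)=f_0x_0(\cdots(f_nx_n\,t))$. For the empty context $\mathsf{unwind}\cdot t\,()\,s\,()\,s'$ is $t\,s\,s'$, and $\mathsf{unwind}\,(f_0,\Delta)\,t\,(x_0,\bar x)\,s\,(x_0',\bar x')\,s'$ means $(f_0,\Delta)(x_0,\bar x)(t)\,s\,s'$ and, for some $(s_1,s)\in f_0x_0$ and $(s_1',s')\in f_0x_0'$, $\mathsf{unwind}\,\Delta\,t\,\bar x\,s_1\,\bar x'\,s_1'$. The step relation $\Delta\vdash\bar x,s,T\to_\pi\bar x',s',T'$, along a path $\pi$ naming the redex, is generated by: $\mathsf{Act}\,a$ steps to $\mathsf{Ret}\,v$ by $\mathsf{unwind}\,\Delta\,(a\,v)\,\bar x\,s\,\bar x'\,s'$; without change of $\bar x,s$, $\mathsf{Seq}(\mathsf{Ret}\,v)K$ steps to $K\,v$, $\mathsf{Par}(\mathsf{Ret}\,v_1)(\mathsf{Ret}\,v_2)K$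 to $K(v_1,v_2)$, and $\mathsf{Morph}\,y\,f\,(\mathsf{Ret}\,v)$ to $\mathsf{Ret}\,v$; steps of $T$ induce steps of $\mathsf{Seq}\,T\,K$, steps of $T_1$ or $T_2$ induce steps of $\mathsf{Par}\,T_1\,T_2\,K$; and $\Delta,f\vdash(\bar x,y),s,T\to_\pi(\bar x',y'),s',T'$ induces a step of $\mathsf{Morph}\,y\,f\,T$ to $\mathsf{Morph}\,y'\,f\,T'$. A path is *good* for $T$ if it leads to an action or to a redex of one of the three $\mathsf{Ret}$ forms. With the empty context, $s$ is *safe* for $T,\pi$ if, whenever $\pi$ is good for $T$, some step $s,T\to_\pi s',T'$ exists. For a finite sequence $\zeta$ of paths, $\mathsf{always}^{\zeta}\,T\,X\,s$ means: for all $s_2$ with $s\to_o^*s_2$, $X\,s_2\,T$ holds and, if $\zeta=\pi::\zeta'$, $s_2$ is safe for $T,\pi$ and $s_2,T\to_\pi s_3,T'$ implies $\mathsf{always}^{\zeta'}\,T'\,X\,s_3$. Let $\mathsf{always}\,T\,X\,s=\forall\zeta.\,\mathsf{always}^\zeta\,T\,X\,s$, $\mathsf{after}\,T\,Q=\mathsf{always}\,T\,(\lambda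 s'T'.\,\forall v.\,T'=\mathsf{Ret}\,v\Rightarrow Q\,v\,s')$ and $\mathsf{vrf}\,e\,Q\,s:\Leftrightarrow S_V(s)\wedge\forall T\in e.\,\mathsf{after}\,T\,Q\,s$. Finally $[\Gamma].\{P\}A\{Q\}@V$ is the set of $e:\mathsf{ST}\,V\,A$ such that $S_V(s)$ and $P\,s$ imply $\mathsf{vrf}\,e\,Q\,s$, for all states $s$ and all values of the specification variables $\Gamma$, on which $P$ and $Q$ may depend. **Theorem (Soundness).** For all resources, types, programs, predicates and states (implications between predicates are meant pointwise in the state): 1. *Properties of $\mathsf{vrf}$.* - vrf_vs: $\mathsf{vrf}\,e\,Q\to S_V$. - vrf_post: if $S_V(s)$ and $Q_1\,r\,s$ imply $Q_2\,r\,s$ for all $r,s$, then $\mathsf{vrf}\,e\,Q_1\to\mathsf{vrf}\,e\,Q_2$. - vrf_ret: $S_V\wedge\overline{Q\,r}\to\mathsf{vrf}\,(\mathsf{ret}\,r)\,Q$. - vrf_bnd: $\mathsf{vrf}\,e_1\,(\lambda x.\,\mathsf{vrf}\,(e_2\,x)\,Q)\to\mathsf{vrf}\,(x\leftarrow e_1;e_2\,x)\,Q$.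 - vrf_par: $(\mathsf{vrf}\,e_1\,Q_1)*(\mathsf{vrf}\,e_2\,Q_2)\to\mathsf{vrf}\,(e_1\parallel e_2)\,(\lambda r.\,(Q_1\,r.1)*(Q_2\,r.2))$. - vrf_frame: $(\mathsf{vrf}\,e\,Q_1)*\overline{Q_2}\to\mathsf{vrf}\,e\,(\lambda r.\,(Q_1\,r)*Q_2)$. - vrf_atm: $S_V\wedge\overline{\lambda s.\,\exists r\,s'.\,a\,r\,s\,s'\wedge\overline{Q\,r}\,s'}\to\mathsf{vrf}\,(\mathsf{atomic}\,a)\,Q$. - vrf_morph: for a morphism $f:V\to W$, $\langle f\rangle(\mathsf{vrf}\,e\,Q)\wedge\overline I^f\to\mathsf{vrf}\,(\mathsf{morph}\,f\,e)\,(\lambda r.\,\langle f\rangle(Q\,r)\wedge I)$; for a family $f:V\to_XW$ and $x\in X$, $\langle f\,x\rangle(\mathsf{vrf}\,e\,Q)\wedge\overline I^f x\to\mathsf{vrf}\,(\mathsf{morph}\,x\,f\,e)\,(\lambda r.\,\exists y.\,\langle f\,y\rangle(Q\,r)\wedge I\,y)$. - Consequently, if $e:[\Gamma].\{P\}A\{Q\}@V$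 and $I$ is $f$-stable (for each value of $\Gamma$), then (LIFT) $\mathsf{morph}\,f\,e:[\Gamma].\{\langle f\rangle P\wedge I\}A\{\langle f\rangle Q\wedge I\}@W$ and (LIFTX) $\mathsf{morph}\,x\,f\,e:[\Gamma].\{\langle f\,x\rangle P\wedge I\,x\}A\{\exists y.\,\langle f\,y\rangle Q\wedge I\,y\}@W$. 2. $\mathsf{ST}\,V\,A$ and each Hoare triple type $[\Gamma].\{P\}A\{Q\}@V$ are complete lattices under inclusion with bottom element $\{\mathsf{Unfinished}\}$. Hence every monotone self-map of either of them, and of each dependent function type $\Pi_{x}.[\Gamma].\{P\}B\{Q\}@V$ with the pointwise order, has a least fixed point, which is the infimum of its pre-fixed points. 3. All program constructors are monotone: sequential composition and parallel composition in both program arguments, and $\mathsf{morph}\,x\,f$ and $\mathsf{morph}\,f$ in theirs ($\mathsf{ret}\,r$ and $\mathsf{atomic}\,a$ have no program argument). -/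

import Mathlib

universe u v w t z

namespace FCSL

/-! ### Partial commutative monoids, states, state spaces -/

/-- A partial commutative monoid.  Partiality is expressed by a total operation together with a
predicate telling which elements are defined: `x` and `y` have a join in the partial sense when
`Defined (join x y)` holds. -/
class PCM (U : Type u) where
  join : U → U → U
  unit : U
  Defined : U → Prop
  join_comm : ∀ x y, join x y = join y x
  join_assoc : ∀ x y z, join (join x y) z = join x (join y z)
  unit_join : ∀ x, join unit x = x
  defined_unit : Defined unit
  defined_of_join : ∀ x y, Defined (join x y) → Defined x

open PCM (join Defined)

/-- States of state-type `(U, T)`: triples of a self, a joint and an other component. -/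
structure State (U T : Type u) where
  self : U
  joint : T
  other : U

namespace State

variable {U T : Type u}

/-- Transposition: exchange the self and other components. -/
def transpose (s : State U T) : State U T := ⟨s.other, s.joint, s.self⟩

/-- Self-framing: add `p` to the self component. -/
def selfFrame [PCM U] (s : State U T) (p : U) : State U T :=
  ⟨join s.self p, s.joint, s.other⟩

/-- Other-framing: add `p` to the other component. -/
def otherFrame [PCM U] (s : State U T) (p : U) : State U T :=
  ⟨s.self, s.joint, join p s.other⟩

end State

/-- A predicate on states is global if it does not depend on the direction of framing. -/
def IsGlobal {U T : Type u} [PCM U] (P : State U T → Prop) : Prop :=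
  ∀ (s : State U T) (p : U), P (s.selfFrame p) ↔ P (s.otherFrame p)

structure IsStateSpace {U T : Type u} [PCM U] (S : State U T → Prop) : Prop where
  valid : ∀ s, S s → Defined (join s.self s.other)
  global : IsGlobal S

/-- Heaps: finite maps from non-null pointers to values of arbitrary small types; `none` is the
undefined heap (the result of storing at the null pointer or of joining overlapping heaps). -/
def Heap : Type 1 := Option (Finmap fun _ : ℕ+ => (Σ α : Type, α))

namespace Heap

def IsDefined (h : Heap) : Prop := h.isSome = true

/-- The set of pointers that a heap contains. -/
def dom (h : Heap) : Finset ℕ+ := Option.elim h ∅ Finmap.keys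

end Heap

/-- Flattening of a state space.  It is a function on the states in `S`; its values elsewhere are
irrelevant, and all conditions are restricted to `S`. -/
structure IsFlattening {U T : Type u} [PCM U] (S : State U T → Prop)
    (flat : State U T → Heap) : Prop where
  valid : ∀ s, S s → (flat s).IsDefined
  frame : ∀ (s : State U T) (p : U), S (s.selfFrame p) → flat (s.selfFrame p) = flat (s.otherFrame p)

/-! ### Transitions and resources -/

structure IsTransition {U T : Type u} [PCM U] (S : State U T → Prop)
    (tr : State U T → State U T → Prop) : Prop where
  functional : ∀ s s₁ s₂, tr s s₁ → tr s s₂ → s₁ = s₂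
  other_fixed : ∀ s s₁, tr s s₁ → s.other = s₁.other
  local_frame : ∀ (s : State U T) (p : U) (s₁ : State U T), tr (s.otherFrame p) s₁ →
    ∃ s₂ : State U T, s₁ = s₂.otherFrame p ∧ tr (s.selfFrame p) (s₂.selfFrame p)
  preserves : ∀ s s₁, tr s s₁ → S s → S s₁

/-- An internal transition preserves the heap domain. -/
def IsInternal {U T : Type u} (S : State U T → Prop) (flat : State U T → Heap)
    (tr : State U T → State U T → Prop) : Prop :=
  ∀ s s₁, S s → tr s s₁ → (flat s).dom = (flat s₁).dom

/-- A resource (state transition system). -/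
structure Resource : Type (u + 1) where
  U : Type u
  T : Type u
  [pcm : PCM U]
  S : State U T → Prop
  flat : State U T → Heap
  internal : Set (State U T → State U T → Prop)
  external : Set (State U T → State U T → Prop)
  isStateSpace : IsStateSpace S
  isFlattening : IsFlattening S flat
  isTransition_of_internal : ∀ tr ∈ internal, IsTransition S tr
  isTransition_of_external : ∀ tr ∈ external, IsTransition S tr
  isInternal_of_internal : ∀ tr ∈ internal, IsInternal S flat tr

attribute [instance] Resource.pcm

namespace Resource

/-- `V`-states. -/
abbrev St (V : Resource.{u}) : Type u := State V.U V.T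

/-- The internal transitions of `V`. -/
abbrev IntTr (V : Resource.{u}) : Type u := {tr : V.St → V.St → Prop // tr ∈ V.internal}

/-- Other-stepping: some transition, internal or external, taken by the environment. -/
def OStep (V : Resource.{u}) (s s₁ : V.St) : Prop :=
  ∃ tr ∈ V.internal ∪ V.external, tr s.transpose s₁.transpose

/-- Reflexive-transitive closure of other-stepping. -/
def OSteps (V : Resource.{u}) : V.St → V.St → Prop := Relation.ReflTransGen V.OStep

/-- Stabilization of a predicate. -/
def stab (V : Resource.{u}) (P : V.St → Prop) (s : V.St) : Prop :=
  ∀ s₁, V.OSteps s s₁ → P s₁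

/-- Subjective separating conjunction. -/
def star (V : Resource.{u}) (P Q : V.St → Prop) (s : V.St) : Prop :=
  ∃ x₁ x₂ : V.U, s.self = join x₁ x₂ ∧
    P ⟨x₁, s.joint, join s.other x₂⟩ ∧ Q ⟨x₂, s.joint, join s.other x₁⟩

end Resource

/-- Atomic actions over `V` with results in `A`. -/
structure AtomicAction (V : Resource.{u}) (A : Type v) where
  rel : A → V.St → V.St → Prop
  internal : ∀ r, rel r ∈ V.internal
  functional : ∀ r₁ r₂ s s₁ s₂, rel r₁ s s₁ → rel r₂ s s₂ → r₁ = r₂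

/-- For every value, an action is an internal transition. -/
def AtomicAction.tr {V : Resource.{u}} {A : Type v} (a : AtomicAction V A) (r : A) : V.IntTr :=
  ⟨a.rel r, a.internal r⟩

/-! ### Morphisms and indexed families of morphisms -/

/-- Indexed family of morphisms from `V` to `W`. -/
structure Family (X : Type w) (V W : Resource.{u}) where
  rel : X → V.St → W.St → Prop
  tr : X → V.IntTr → W.IntTr
  rel_space : ∀ x sv sw, rel x sv sw → V.S sv ∧ W.S sw
  sim_internal : ∀ x (q : V.IntTr) sv sv₁ sw, q.1 sv sv₁ → rel x sv sw →
    ∃ x₁ sw₁, (tr x q).1 sw sw₁ ∧ rel x₁ sv₁ sw₁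
  sim_other : ∀ x sv sw sw₁, W.OSteps sw sw₁ → rel x sv sw →
    ∃ sv₁, V.OSteps sv sv₁ ∧ rel x sv₁ sw₁
  functional : ∀ x sv₁ sv₂ sw, rel x sv₁ sw → rel x sv₂ sw → sv₁ = sv₂
  frame : ∃ φ : W.U → V.U, ∀ x sv (sw : W.St) p, rel x sv (sw.otherFrame p) →
    ∃ sv₁ : V.St, sv = sv₁.otherFrame (φ p) ∧ rel x (sv₁.selfFrame (φ p)) (sw.selfFrame p)
  other_fixed : ∀ x x₁ sv sv₁ sw sw₁, rel x sv sw → rel x₁ sv₁ sw₁ →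
    sw.other = sw₁.other → sv.other = sv₁.other
  index_injective : ∀ x₁ x₂ sv sw₁ sw₂, rel x₁ sv sw₁ → rel x₂ sv sw₂ → x₁ = x₂

namespace Family

variable {X : Type w} {V W : Resource.{u}}

/-- The image `⟨f x⟩ P` of a predicate on `V`-states. -/
def image (f : Family X V W) (x : X) (P : V.St → Prop) (sw : W.St) : Prop :=
  ∃ sv, f.rel x sv sw ∧ P sv

/-- `f`-stepping on pairs of an index and a `W`-state.  Interference keeps the index. -/
def FStep (f : Family X V W) (c c₁ : X × W.St) : Prop :=
  (∃ (q : V.IntTr) (sv sv₁ : V.St), f.rel c.1 sv c.2 ∧ f.rel c₁.1 sv₁ c₁.2 ∧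
    q.1 sv sv₁ ∧ (f.tr c.1 q).1 c.2 c₁.2) ∨
  (c₁.1 = c.1 ∧ W.OStep c.2 c₁.2)

def FSteps (f : Family X V W) : X × W.St → X × W.St → Prop := Relation.ReflTransGen f.FStep

/-- `f`-stabilization. -/
def fstab (f : Family X V W) (P : X → W.St → Prop) (x : X) (s : W.St) : Prop :=
  ∀ x₁ s₁, f.FSteps (x, s) (x₁, s₁) → P x₁ s₁

/-- `f`-stability. -/
def FStable (f : Family X V W) (P : X → W.St → Prop) : Prop :=
  ∀ x s, P x s → ∀ x₁ s₁, f.FSteps (x, s) (x₁, s₁) → P x₁ s₁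

end Family

/-- Morphisms from `V` to `W`. -/
structure Morphism (V W : Resource.{u}) where
  rel : V.St → W.St → Prop
  tr : V.IntTr → W.IntTr
  rel_space : ∀ sv sw, rel sv sw → V.S sv ∧ W.S sw
  sim_internal : ∀ (q : V.IntTr) sv sv₁ sw, q.1 sv sv₁ → rel sv sw →
    ∃ sw₁, (tr q).1 sw sw₁ ∧ rel sv₁ sw₁
  functional : ∀ sv₁ sv₂ sw, rel sv₁ sw → rel sv₂ sw → sv₁ = sv₂
  sim_other : ∀ sv sw sw₁, W.OSteps sw sw₁ → rel sv sw →
    ∃ sv₁, V.OSteps sv sv₁ ∧ rel sv₁ sw₁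
  frame : ∃ φ : W.U → V.U, ∀ sv (sw : W.St) p, rel sv (sw.otherFrame p) →
    ∃ sv₁ : V.St, sv = sv₁.otherFrame (φ p) ∧ rel (sv₁.selfFrame (φ p)) (sw.selfFrame p)
  other_fixed : ∀ sv sv₁ sw sw₁, rel sv sw → rel sv₁ sw₁ →
    sw.other = sw₁.other → sv.other = sv₁.other

namespace Morphism

variable {V W : Resource.{u}}

/-- A morphism as a family over the one-element index type. -/
def toFamily (f : Morphism V W) : Family PUnit.{w + 1} V W where
  rel _ := f.rel
  tr _ := f.tr
  rel_space _ := f.rel_space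
  sim_internal _ q sv sv₁ sw h₁ h₂ :=
    let ⟨sw₁, h⟩ := f.sim_internal q sv sv₁ sw h₁ h₂
    ⟨PUnit.unit, sw₁, h⟩
  sim_other _ := f.sim_other
  functional _ := f.functional
  frame := let ⟨φ, h⟩ := f.frame; ⟨φ, fun _ => h⟩
  other_fixed _ _ := f.other_fixed
  index_injective _ _ _ _ _ _ _ := rfl

/-- The image `⟨f⟩ P` of a predicate on `V`-states. -/
def image (f : Morphism V W) (P : V.St → Prop) (sw : W.St) : Prop :=
  ∃ sv, f.rel sv sw ∧ P sv

/-- `f`-stepping. -/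
def FStep (f : Morphism V W) (sw sw₁ : W.St) : Prop :=
  (∃ (q : V.IntTr) (sv sv₁ : V.St), f.rel sv sw ∧ f.rel sv₁ sw₁ ∧
    q.1 sv sv₁ ∧ (f.tr q).1 sw sw₁) ∨
  W.OStep sw sw₁

def FSteps (f : Morphism V W) : W.St → W.St → Prop := Relation.ReflTransGen f.FStep

/-- `f`-stabilization. -/
def fstab (f : Morphism V W) (P : W.St → Prop) (s : W.St) : Prop :=
  ∀ s₁, f.FSteps s s₁ → P s₁

/-- `f`-stability. -/
def FStable (f : Morphism V W) (P : W.St → Prop) : Prop :=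
  ∀ s, P s → ∀ s₁, f.FSteps s s₁ → P s₁

end Morphism

/-! ### Action trees and programs -/

/-- Action trees over the resource `V` returning values in `A`. -/
inductive ActionTree : Resource.{u} → Type v → Type (max (u + 1) (v + 1) (w + 1))
  | unfinished {V : Resource.{u}} {A : Type v} : ActionTree V A
  | ret {V : Resource.{u}} {A : Type v} (r : A) : ActionTree V A
  | act {V : Resource.{u}} {A : Type v} (a : AtomicAction V A) : ActionTree V A
  | seq {V : Resource.{u}} {A B : Type v} (T : ActionTree V B) (K : B → ActionTree V A) : ActionTree V A
  | par {V : Resource.{u}} {A B₁ B₂ : Type v} (T₁ : ActionTree V B₁) (T₂ : ActionTree V B₂)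
      (K : B₁ × B₂ → ActionTree V A) : ActionTree V A
  | morph {V W : Resource.{u}} {A : Type v} {X : Type w} (x : X) (f : Family X W V)
      (T : ActionTree W A) : ActionTree V A

/-- Programs: sets of trees containing `unfinished`, ordered by inclusion (the order of the
subtype). -/
abbrev Prog (V : Resource.{u}) (A : Type v) : Type (max (u + 1) (v + 1) (w + 1)) :=
  {e : Set (ActionTree.{u, v, w} V A) // ActionTree.unfinished ∈ e}

namespace Prog

variable {V W : Resource.{u}} {A B A₁ A₂ : Type v} {X : Type w}

/-- The program whose only tree is `unfinished`. -/
def bottom : Prog.{u, v, w} V A := ⟨{ActionTree.unfinished}, rfl⟩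

def ret (r : A) : Prog.{u, v, w} V A := ⟨{ActionTree.unfinished, ActionTree.ret r}, Or.inl rfl⟩

def bnd (e₁ : Prog.{u, v, w} V B) (e₂ : B → Prog.{u, v, w} V A) : Prog.{u, v, w} V A :=
  ⟨{ActionTree.unfinished} ∪
    {T | ∃ T₁ K, T = ActionTree.seq T₁ K ∧ T₁ ∈ e₁.1 ∧ ∀ x, K x ∈ (e₂ x).1}, Or.inl rfl⟩

def par (e₁ : Prog.{u, v, w} V A₁) (e₂ : Prog.{u, v, w} V A₂) : Prog.{u, v, w} V (A₁ × A₂) :=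
  ⟨{ActionTree.unfinished} ∪
    {T | ∃ T₁ T₂, T = ActionTree.par T₁ T₂ ActionTree.ret ∧ T₁ ∈ e₁.1 ∧ T₂ ∈ e₂.1}, Or.inl rfl⟩

def atomic (a : AtomicAction V A) : Prog.{u, v, w} V A := ⟨{ActionTree.unfinished, ActionTree.act a}, Or.inl rfl⟩

/-- Lifting a program along an indexed family, starting from the index `x`. -/
def morphX (x : X) (f : Family X V W) (e : Prog.{u, v, w} V A) : Prog.{u, v, w} W A :=
  ⟨{ActionTree.unfinished} ∪ {T | ∃ T₁ ∈ e.1, T = ActionTree.morph x f T₁}, Or.inl rfl⟩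

/-- Lifting a program along a morphism: the case of the one-element index type. -/
def morph (f : Morphism V W) (e : Prog.{u, v, w} V A) : Prog.{u, v, w} W A :=
  morphX PUnit.unit f.toFamily e

end Prog

/-! ### Operational semantics of trees -/

/-- Morphism contexts: composable sequences of families, of resource type `V → W`.  The head of
the sequence is the outermost family. -/
inductive MCtx (V : Resource.{u}) : Resource.{u} → Type (max (u + 1) (w + 1))
  | nil : MCtx V V
  | cons {V₁ W : Resource.{u}} {X : Type w} (f : Family X V₁ W) (Δ : MCtx V V₁) : MCtx V W

namespace MCtx

variable {V : Resource.{u}}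

/-- Tuples of indexes for the families of a context. -/
def Idx : {W : Resource.{u}} → MCtx.{u, w} V W → Type w
  | _, nil => PUnit
  | _, cons (X := X) _ Δ => X × Δ.Idx

/-- Extending a context at the innermost end. -/
def snoc {X : Type w} {V₁ : Resource.{u}} : {W : Resource.{u}} →
    MCtx.{u, w} V W → Family X V₁ V → MCtx.{u, w} V₁ W
  | _, nil, f => cons f nil
  | _, cons g Δ, f => cons g (Δ.snoc f)

/-- Extending a tuple of indexes at the innermost end. -/
def snocIdx {X : Type w} {V₁ : Resource.{u}} : {W : Resource.{u}} →
    (Δ : MCtx.{u, w} V W) → (f : Family X V₁ V) → Δ.Idx → X → (Δ.snoc f).Idx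
  | _, nil, _, _, y => (y, PUnit.unit)
  | _, cons _ Δ, f, xs, y => (xs.1, Δ.snocIdx f xs.2 y)

/-- The image of an internal transition under all families of a context. -/
def apply : {W : Resource.{u}} → (Δ : MCtx.{u, w} V W) → Δ.Idx → V.IntTr → W.IntTr
  | _, nil, _, q => q
  | _, cons f Δ, xs, q => f.tr xs.1 (Δ.apply xs.2 q)

/-- `Δ.unwind q xs s xs₁ s₁`: in the context `Δ`, the transition `q` steps from `s` to `s₁`, and
changes the indexes from `xs` to `xs₁`. -/
def unwind : {W : Resource.{u}} → (Δ : MCtx.{u, w} V W) → V.IntTr →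
    Δ.Idx → W.St → Δ.Idx → W.St → Prop
  | _, nil, q, _, s, _, s₁ => q.1 s s₁
  | _, cons f Δ, q, xs, s, xs₁, s₁ =>
      (f.tr xs.1 (Δ.apply xs.2 q)).1 s s₁ ∧
      ∃ r r₁, f.rel xs.1 r s ∧ Δ.unwind q xs.2 r xs₁.2 r₁ ∧ f.rel xs₁.1 r₁ s₁

end MCtx

/-- Paths: positions in trees. -/
inductive TreePath : Type
  | choiceAct
  | seqRet
  | seqStep (π : TreePath)
  | parRet
  | parL (π : TreePath)
  | parR (π : TreePath)
  | morphRet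
  | morphStep (π : TreePath)

/-- The judgment `Δ ⊢ xs, s, T → xs₁, s₁, T₁` along a path. -/
inductive Step : {V W : Resource.{u}} → {A : Type v} → (Δ : MCtx.{u, w} V W) →
    Δ.Idx → W.St → ActionTree.{u, v, w} V A → TreePath → Δ.Idx → W.St → ActionTree.{u, v, w} V A → Prop
  | act {V W : Resource.{u}} {A : Type v} {Δ : MCtx.{u, w} V W} {xs xs₁ : Δ.Idx} {s s₁ : W.St}
      {a : AtomicAction V A} {r : A} (h : Δ.unwind (a.tr r) xs s xs₁ s₁) :
      Step Δ xs s (ActionTree.act a) TreePath.choiceAct xs₁ s₁ (ActionTree.ret r)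
  | seqRet {V W : Resource.{u}} {A B : Type v} {Δ : MCtx.{u, w} V W} {xs : Δ.Idx} {s : W.St}
      {r : B} {K : B → ActionTree.{u, v, w} V A} :
      Step Δ xs s (ActionTree.seq (ActionTree.ret r) K) TreePath.seqRet xs s (K r)
  | seqStep {V W : Resource.{u}} {A B : Type v} {Δ : MCtx.{u, w} V W} {xs xs₁ : Δ.Idx}
      {s s₁ : W.St} {T T₁ : ActionTree.{u, v, w} V B} {K : B → ActionTree.{u, v, w} V A} {π : TreePath}
      (h : Step Δ xs s T π xs₁ s₁ T₁) :
      Step Δ xs s (ActionTree.seq T K) (TreePath.seqStep π) xs₁ s₁ (ActionTree.seq T₁ K)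
  | parRet {V W : Resource.{u}} {A B₁ B₂ : Type v} {Δ : MCtx.{u, w} V W} {xs : Δ.Idx} {s : W.St}
      {r₁ : B₁} {r₂ : B₂} {K : B₁ × B₂ → ActionTree.{u, v, w} V A} :
      Step Δ xs s (ActionTree.par (ActionTree.ret r₁) (ActionTree.ret r₂) K) TreePath.parRet xs s (K (r₁, r₂))
  | parL {V W : Resource.{u}} {A B₁ B₂ : Type v} {Δ : MCtx.{u, w} V W} {xs xs₁ : Δ.Idx}
      {s s₁ : W.St} {T₁ T : ActionTree.{u, v, w} V B₁} {T₂ : ActionTree.{u, v, w} V B₂}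
      {K : B₁ × B₂ → ActionTree.{u, v, w} V A} {π : TreePath}
      (h : Step Δ xs s T₁ π xs₁ s₁ T) :
      Step Δ xs s (ActionTree.par T₁ T₂ K) (TreePath.parL π) xs₁ s₁ (ActionTree.par T T₂ K)
  | parR {V W : Resource.{u}} {A B₁ B₂ : Type v} {Δ : MCtx.{u, w} V W} {xs xs₁ : Δ.Idx}
      {s s₁ : W.St} {T₁ : ActionTree.{u, v, w} V B₁} {T₂ T : ActionTree.{u, v, w} V B₂}
      {K : B₁ × B₂ → ActionTree.{u, v, w} V A} {π : TreePath}
      (h : Step Δ xs s T₂ π xs₁ s₁ T) :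
      Step Δ xs s (ActionTree.par T₁ T₂ K) (TreePath.parR π) xs₁ s₁ (ActionTree.par T₁ T K)
  | morphRet {V V₁ W : Resource.{u}} {A : Type v} {X : Type w} {Δ : MCtx.{u, w} V W}
      {xs : Δ.Idx} {s : W.St} {y : X} {f : Family X V₁ V} {r : A} :
      Step Δ xs s (ActionTree.morph y f (ActionTree.ret r)) TreePath.morphRet xs s (ActionTree.ret r)
  | morphStep {V V₁ W : Resource.{u}} {A : Type v} {X : Type w} {Δ : MCtx.{u, w} V W}
      {xs xs₁ : Δ.Idx} {s s₁ : W.St} {y y₁ : X} {f : Family X V₁ V}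
      {T T₁ : ActionTree.{u, v, w} V₁ A} {π : TreePath}
      (h : Step (Δ.snoc f) (Δ.snocIdx f xs y) s T π (Δ.snocIdx f xs₁ y₁) s₁ T₁) :
      Step Δ xs s (ActionTree.morph y f T) (TreePath.morphStep π) xs₁ s₁ (ActionTree.morph y₁ f T₁)

/-- Good paths: those that determine an action or a redex. -/
inductive Good : {V : Resource.{u}} → {A : Type v} → ActionTree.{u, v, w} V A → TreePath → Prop
  | act {V : Resource.{u}} {A : Type v} {a : AtomicAction V A} : Good (ActionTree.act a) TreePath.choiceAct
  | seqRet {V : Resource.{u}} {A B : Type v} {r : B} {K : B → ActionTree.{u, v, w} V A} :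
      Good (ActionTree.seq (ActionTree.ret r) K) TreePath.seqRet
  | seqStep {V : Resource.{u}} {A B : Type v} {T : ActionTree.{u, v, w} V B}
      {K : B → ActionTree.{u, v, w} V A} {π : TreePath} (h : Good T π) :
      Good (ActionTree.seq T K) (TreePath.seqStep π)
  | parRet {V : Resource.{u}} {A B₁ B₂ : Type v} {r₁ : B₁} {r₂ : B₂}
      {K : B₁ × B₂ → ActionTree.{u, v, w} V A} :
      Good (ActionTree.par (ActionTree.ret r₁) (ActionTree.ret r₂) K) TreePath.parRet
  | parL {V : Resource.{u}} {A B₁ B₂ : Type v} {T₁ : ActionTree.{u, v, w} V B₁}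
      {T₂ : ActionTree.{u, v, w} V B₂} {K : B₁ × B₂ → ActionTree.{u, v, w} V A} {π : TreePath}
      (h : Good T₁ π) : Good (ActionTree.par T₁ T₂ K) (TreePath.parL π)
  | parR {V : Resource.{u}} {A B₁ B₂ : Type v} {T₁ : ActionTree.{u, v, w} V B₁}
      {T₂ : ActionTree.{u, v, w} V B₂} {K : B₁ × B₂ → ActionTree.{u, v, w} V A} {π : TreePath}
      (h : Good T₂ π) : Good (ActionTree.par T₁ T₂ K) (TreePath.parR π)
  | morphRet {V W : Resource.{u}} {A : Type v} {X : Type w} {x : X} {f : Family X W V} {r : A} :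
      Good (ActionTree.morph x f (ActionTree.ret r)) TreePath.morphRet
  | morphStep {V W : Resource.{u}} {A : Type v} {X : Type w} {x : X} {f : Family X W V}
      {T : ActionTree.{u, v, w} W A} {π : TreePath} (h : Good T π) :
      Good (ActionTree.morph x f T) (TreePath.morphStep π)

section Transformers

variable {V : Resource.{u}} {A : Type v}

/-- Stepping in the empty morphism context. -/
def Step₀ (s : V.St) (T : ActionTree.{u, v, w} V A) (π : TreePath) (s₁ : V.St) (T₁ : ActionTree.{u, v, w} V A) :
    Prop :=
  Step (MCtx.nil : MCtx.{u, w} V V) (PUnit.unit : PUnit.{w + 1}) s T π (PUnit.unit : PUnit.{w + 1})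
    s₁ T₁

/-- The state `s` is safe for the tree `T` and the path `π`. -/
def Safe (T : ActionTree.{u, v, w} V A) (π : TreePath) (s : V.St) : Prop :=
  Good T π → ∃ s₁ T₁, Step₀ s T π s₁ T₁

/-! ### Predicate transformers -/

/-- The modality `always` for a given sequence of paths. -/
def alwaysAlong (X : V.St → ActionTree.{u, v, w} V A → Prop) :
    List TreePath → ActionTree.{u, v, w} V A → V.St → Prop
  | [], T, s => ∀ s₂, V.OSteps s s₂ → X s₂ T
  | π :: ζ, T, s => ∀ s₂, V.OSteps s s₂ →
      Safe T π s₂ ∧ X s₂ T ∧ ∀ s₃ T₁, Step₀ s₂ T π s₃ T₁ → alwaysAlong X ζ T₁ s₃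

def always (T : ActionTree.{u, v, w} V A) (X : V.St → ActionTree.{u, v, w} V A → Prop) (s : V.St) : Prop :=
  ∀ ζ, alwaysAlong X ζ T s

def after (T : ActionTree.{u, v, w} V A) (Q : A → V.St → Prop) (s : V.St) : Prop :=
  always T (fun s₁ T₁ => ∀ r, T₁ = ActionTree.ret r → Q r s₁) s

/-- The predicate transformer on programs. -/
def vrf (e : Prog.{u, v, w} V A) (Q : A → V.St → Prop) (s : V.St) : Prop :=
  V.S s ∧ ∀ T ∈ e.1, after T Q s

/-- `e` satisfies the Hoare triple with precondition `P` and postcondition `Q`, in a context `Γ` of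
specification variables. -/
def Triple {Γ : Type t} (P : Γ → V.St → Prop) (Q : Γ → A → V.St → Prop)
    (e : Prog.{u, v, w} V A) : Prop :=
  ∀ g s, V.S s → P g s → vrf e (Q g) s

/-- The Hoare triple type, ordered by inclusion of sets of trees. -/
abbrev HoareType {Γ : Type t} (P : Γ → V.St → Prop) (Q : Γ → A → V.St → Prop) :
    Type (max (u + 1) (v + 1) (w + 1)) :=
  {e : Prog.{u, v, w} V A // Triple P Q e}

end Transformers

/-! ### Order-theoretic vocabulary -/

/-- A partial order is a complete lattice: all suprema and infima exist. -/
def IsCompleteLatticeOrder (L : Type z) [PartialOrder L] : Prop :=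
  ∀ M : Set L, (∃ a, IsLUB M a) ∧ (∃ b, IsGLB M b)

/-- Every monotone self-map has a least fixed point, and it is the infimum of the pre-fixed
points. -/
def HasLeastFixedPoints (L : Type z) [PartialOrder L] : Prop :=
  ∀ F : L → L, Monotone F → ∃ p, IsGLB {e | F e ≤ e} p ∧ IsLeast {e | F e = e} p

end FCSL

open FCSL

namespace FCSL

open FCSL.PCM (join)

/-! ### Order theory -/

/-! `always` is a greatest invariant: it holds as soon as the pair of state and tree lies in a
relation closed under interference and under the steps of the tree, and entailing safety and the
required property (`always_of_invariant`). Each `vrf` rule except `vrf_vs` amounts to a choice of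
such an invariant.

For `vrf_par` and `vrf_frame` the invariant is a separating conjunction. Interference on the whole
is interference on both parts (`OSteps.star`), and a step of one part is interference for the other
(`IntTr.oStep`). Locality only transports a step of a part to a step of the whole. The converse
(`step_star`) combines safety, which provides a step of the part, with determinism of steps along a
given path (`Step.functional`), which forces its transport to be the step at hand.

For `vrf_morph` the invariant says that the current state is related by the family to a state where
the inner tree is verified. Inner steps are simulated outside (`Step.cons`), which gives safety;
outer steps project back (`Step.of_cons`), because `unwind` records the inner states and a family
relates each outer state to at most one inner state.

The order-theoretic claims hold because `vrf` tests each tree separately and so passes to unions;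
least fixed points then follow by Knaster–Tarski. -/

theorem isCompleteLatticeOrder_of_isLUB {L : Type z} [PartialOrder L]
    (h : ∀ M : Set L, ∃ a, IsLUB M a) : IsCompleteLatticeOrder L := by
  intro M
  refine ⟨h M, ?_⟩
  obtain ⟨b, hb⟩ := h (lowerBounds M)
  exact ⟨b, isLUB_lowerBounds.mp hb⟩

/-- Knaster–Tarski. Only infima enter, so for dependent functions pointwise infima are enough. -/
theorem hasLeastFixedPoints_of_isGLB {L : Type z} [PartialOrder L]
    (h : ∀ M : Set L, ∃ b, IsGLB M b) : HasLeastFixedPoints L := by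
  intro F hF
  obtain ⟨p, hp⟩ := h {e | F e ≤ e}
  have h₁ : F p ≤ p := hp.2 fun e he => (hF (hp.1 he)).trans he
  have h₂ : p ≤ F p := hp.1 (hF h₁)
  exact ⟨p, hp, le_antisymm h₁ h₂, fun e he => hp.1 (le_of_eq he)⟩

theorem IsCompleteLatticeOrder.hasLeastFixedPoints {L : Type z} [PartialOrder L]
    (h : IsCompleteLatticeOrder L) : HasLeastFixedPoints L :=
  hasLeastFixedPoints_of_isGLB fun M => (h M).2

theorem hasLeastFixedPoints_pi {ι : Type z} {L : ι → Type w} [∀ i, PartialOrder (L i)]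
    (h : ∀ i, IsCompleteLatticeOrder (L i)) : HasLeastFixedPoints (∀ i, L i) := by
  refine hasLeastFixedPoints_of_isGLB fun M => ?_
  choose b hb using fun i => (h i ((fun g => g i) '' M)).2
  exact ⟨b, isGLB_pi.mpr hb⟩

/-! ### Resources -/

namespace Resource

variable {V : Resource.{u}}

/-- Globality moves the whole self component across, so membership depends only on the joint
component and on the commutative join of self and other. -/
theorem S_transpose {s : V.St} : V.S s.transpose ↔ V.S s := by
  have h : ∀ (a b : V.U) (j : V.T), V.S ⟨a, j, b⟩ ↔ V.S ⟨PCM.unit, j, join a b⟩ := by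
    intro a b j
    have := V.isStateSpace.global ⟨PCM.unit, j, b⟩ a
    simpa [State.selfFrame, State.otherFrame, PCM.unit_join] using this
  obtain ⟨a, j, b⟩ := s
  change V.S ⟨b, j, a⟩ ↔ V.S ⟨a, j, b⟩
  rw [h b a, h a b, PCM.join_comm b a]

theorem S_selfFrame {x₁ x₂ o : V.U} {j : V.T} (h : V.S ⟨x₁, j, join o x₂⟩) :
    V.S ⟨join x₁ x₂, j, o⟩ := by
  rw [PCM.join_comm] at h
  exact (V.isStateSpace.global ⟨x₁, j, o⟩ x₂).mpr h

theorem isTransition {tr : V.St → V.St → Prop} (h : tr ∈ V.internal ∪ V.external) :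
    IsTransition V.S tr :=
  h.elim (V.isTransition_of_internal tr) (V.isTransition_of_external tr)

theorem IntTr.isTransition (q : V.IntTr) : IsTransition V.S q.1 :=
  V.isTransition_of_internal q.1 q.2

theorem OStep.preserves {s s₁ : V.St} (h : V.OStep s s₁) (hs : V.S s) : V.S s₁ := by
  obtain ⟨tr, htr, h⟩ := h
  exact S_transpose.mp ((isTransition htr).preserves _ _ h (S_transpose.mpr hs))

theorem OSteps.preserves {s s₁ : V.St} (h : V.OSteps s s₁) (hs : V.S s) : V.S s₁ := by
  induction h with
  | refl => exact hs
  | tail _ h ih => exact h.preserves ih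

/-- Locality moves a frame between the two components, keeping the rest of the other component. -/
theorem local_transfer {tr : V.St → V.St → Prop} (h : IsTransition V.S tr) {a o p : V.U}
    {j : V.T} {s₁ : V.St} (hs : tr ⟨a, j, join o p⟩ s₁) :
    ∃ a₁ j₁, s₁ = ⟨a₁, j₁, join o p⟩ ∧ tr ⟨join a p, j, o⟩ ⟨join a₁ p, j₁, o⟩ := by
  have hs' : tr (State.otherFrame ⟨a, j, o⟩ p) s₁ := by
    simpa [State.otherFrame, PCM.join_comm p o] using hs
  obtain ⟨⟨a₁, j₁, o₁⟩, rfl, h₂⟩ := h.local_frame _ _ _ hs'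
  -- Joins need not be cancellative; `o = o₁` comes from the framed step `h₂`, whose other
  -- components are exactly `o` and `o₁`.
  have : o = o₁ := h.other_fixed _ _ h₂
  subst this
  exact ⟨a₁, j₁, by simp [State.otherFrame, PCM.join_comm], h₂⟩

/-- An environment step of the whole is an environment step of the left part. -/
theorem OStep.star_left {x₁ x₂ o : V.U} {j : V.T} {s₁ : V.St}
    (h : V.OStep ⟨join x₁ x₂, j, o⟩ s₁) :
    ∃ j₁ o₁, s₁ = ⟨join x₁ x₂, j₁, o₁⟩ ∧ V.OStep ⟨x₁, j, join o x₂⟩ ⟨x₁, j₁, join o₁ x₂⟩ := by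
  obtain ⟨tr, htr, h⟩ := h
  obtain ⟨a₁, j₁, h₁, h₂⟩ := local_transfer (isTransition htr) (a := o) (j := j) h
  refine ⟨j₁, a₁, ?_, tr, htr, h₂⟩
  obtain ⟨b, k, c⟩ := s₁
  simpa [State.transpose, and_comm, and_assoc, and_left_comm] using h₁

theorem OStep.star {x₁ x₂ o : V.U} {j : V.T} {s₁ : V.St} (h : V.OStep ⟨join x₁ x₂, j, o⟩ s₁) :
    ∃ j₁ o₁, s₁ = ⟨join x₁ x₂, j₁, o₁⟩ ∧ V.OStep ⟨x₁, j, join o x₂⟩ ⟨x₁, j₁, join o₁ x₂⟩ ∧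
      V.OStep ⟨x₂, j, join o x₁⟩ ⟨x₂, j₁, join o₁ x₁⟩ := by
  obtain ⟨j₁, o₁, rfl, h₁⟩ := h.star_left
  -- The mirrored use of `star_left` concerns the same target state, so its joint and other
  -- components agree with the ones already found.
  rw [PCM.join_comm] at h
  obtain ⟨j₂, o₂, h₂, h₃⟩ := h.star_left
  simp only [State.mk.injEq] at h₂
  obtain ⟨-, rfl, rfl⟩ := h₂
  exact ⟨j₁, o₁, rfl, h₁, h₃⟩

theorem OSteps.star {x₁ x₂ o : V.U} {j : V.T} {s₁ : V.St}
    (h : V.OSteps ⟨join x₁ x₂, j, o⟩ s₁) :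
    ∃ j₁ o₁, s₁ = ⟨join x₁ x₂, j₁, o₁⟩ ∧ V.OSteps ⟨x₁, j, join o x₂⟩ ⟨x₁, j₁, join o₁ x₂⟩ ∧
      V.OSteps ⟨x₂, j, join o x₁⟩ ⟨x₂, j₁, join o₁ x₁⟩ := by
  induction h with
  | refl => exact ⟨j, o, rfl, .refl, .refl⟩
  | tail _ h ih =>
    obtain ⟨j₁, o₁, rfl, h₁, h₂⟩ := ih
    obtain ⟨j₂, o₂, rfl, h₃, h₄⟩ := h.star
    exact ⟨j₂, o₂, rfl, h₁.tail h₃, h₂.tail h₄⟩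

/-- An internal step of one thread is an environment step of the other. -/
theorem IntTr.oStep (q : V.IntTr) {x₁ x₂ o y₁ : V.U} {j j₁ : V.T}
    (h : q.1 ⟨x₁, j, join o x₂⟩ ⟨y₁, j₁, join o x₂⟩) :
    V.OStep ⟨x₂, j, join o x₁⟩ ⟨x₂, j₁, join o y₁⟩ := by
  rw [PCM.join_comm o x₂] at h
  obtain ⟨a₁, j₂, h₁, h₂⟩ := local_transfer q.isTransition h
  simp only [State.mk.injEq] at h₁
  obtain ⟨rfl, rfl, -⟩ := h₁
  refine ⟨q.1, Or.inl q.2, ?_⟩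
  simpa [State.transpose, PCM.join_comm o] using h₂

theorem stab_of_oSteps {P : V.St → Prop} {s s₁ : V.St} (h : V.stab P s) (hs : V.OSteps s s₁) :
    V.stab P s₁ :=
  fun _ h₂ => h _ (hs.trans h₂)

end Resource

/-! ### Contexts -/

namespace MCtx

variable {V W : Resource.{u}}

theorem snocIdx_injective {X : Type w} {V₁ : Resource.{u}} (Δ : MCtx.{u, w} V W)
    (f : Family X V₁ V) {xs ys : Δ.Idx} {x y : X} (h : Δ.snocIdx f xs x = Δ.snocIdx f ys y) :
    xs = ys ∧ x = y := by
  induction Δ with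
  | nil => exact ⟨rfl, congrArg Prod.fst h⟩
  | cons g Δ ih =>
    obtain ⟨h₁, h₂⟩ := ih (congrArg Prod.snd h)
    exact ⟨Prod.ext (Prod.ext_iff.mp h).1 h₁, h₂⟩

theorem apply_of_unwind {Δ : MCtx.{u, w} V W} {q : V.IntTr} {xs xs₁ : Δ.Idx} {s s₁ : W.St}
    (h : Δ.unwind q xs s xs₁ s₁) : (Δ.apply xs q).1 s s₁ := by
  cases Δ with
  | nil => exact h
  | cons f Δ => exact h.1

/-- Determinism propagates outwards from the action: the initial inner states agree by
`Family.functional`, the final ones and the results by induction. The new outer index is then fixed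
by `index_injective`, and the outer state by the image transition, since one inner state may be
related to several outer ones. -/
theorem unwind_functional {Δ : MCtx.{u, w} V W} {A : Type v} {a : AtomicAction V A} {r r' : A}
    {xs ys zs : Δ.Idx} {s s₁ s₂ : W.St} (h₁ : Δ.unwind (a.tr r) xs s ys s₁)
    (h₂ : Δ.unwind (a.tr r') xs s zs s₂) : r = r' ∧ ys = zs ∧ s₁ = s₂ := by
  induction Δ with
  | nil =>
    obtain rfl := a.functional _ _ _ _ _ h₁ h₂
    exact ⟨rfl, rfl, (a.tr r).isTransition.functional _ _ _ h₁ h₂⟩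
  | cons f Δ ih =>
    obtain ⟨t₁, p, p₁, hp, hu, hp₁⟩ := h₁
    obtain ⟨t₂, p', p₂, hp', hu', hp₂⟩ := h₂
    obtain rfl := f.functional _ _ _ _ hp hp'
    obtain ⟨rfl, he, rfl⟩ := ih hu hu'
    exact ⟨rfl, Prod.ext (f.index_injective _ _ _ _ _ hp₁ hp₂) he,
      (Resource.IntTr.isTransition _).functional _ _ _ t₁ t₂⟩

theorem unwind_local {Δ : MCtx.{u, w} V W} {q : V.IntTr} {xs xs₁ : Δ.Idx} {s s₁ : W.St} {p : W.U}
    (h : Δ.unwind q xs (s.otherFrame p) xs₁ s₁) :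
    ∃ s₂ : W.St, s₁ = s₂.otherFrame p ∧ Δ.unwind q xs (s.selfFrame p) xs₁ (s₂.selfFrame p) := by
  induction Δ with
  | nil => exact q.isTransition.local_frame _ _ _ h
  | cons f Δ ih =>
    obtain ⟨ht, r, r₁, hr, hu, hr₁⟩ := h
    obtain ⟨s₂, rfl, ht₂⟩ := (Resource.IntTr.isTransition _).local_frame _ _ _ ht
    obtain ⟨φ, hφ⟩ := f.frame
    obtain ⟨t, rfl, hrt⟩ := hφ _ _ _ _ hr
    obtain ⟨t₁, rfl, hrt₁⟩ := hφ _ _ _ _ hr₁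
    obtain ⟨t₂, he, hu₂⟩ := ih hu
    -- The family's frame condition and the induction hypothesis each split the final inner state,
    -- into `t₁` and `t₂`. In place of cancellation, both other components equal that of `t`: for
    -- `t₁` because the family determines inner others from outer ones, for `t₂` because transitions
    -- fix them.
    have h₁ := f.other_fixed _ _ _ _ _ _ hrt hrt₁
      ((Resource.IntTr.isTransition _).other_fixed _ _ ht₂)
    have h₂ := (Resource.IntTr.isTransition _).other_fixed _ _ (apply_of_unwind hu₂)
    have h₃ : t₂ = t₁ := by
      obtain ⟨a, j, o⟩ := t₁
      obtain ⟨a', j', o'⟩ := t₂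
      simp only [State.otherFrame, State.mk.injEq] at he ⊢
      exact ⟨he.1.symm, he.2.1.symm, h₂.symm.trans h₁⟩
    subst h₃
    exact ⟨s₂, rfl, ht₂, _, _, hrt, hu₂, hrt₁⟩

end MCtx

/-! ### Steps -/

namespace Step

theorem good {V W : Resource.{u}} {A : Type v} {Δ : MCtx.{u, w} V W} {xs xs₁ : Δ.Idx}
    {s s₁ : W.St} {T T₁ : ActionTree.{u, v, w} V A} {π : TreePath}
    (h : Step Δ xs s T π xs₁ s₁ T₁) : Good T π := by
  induction h with
  | act => exact .act
  | seqRet => exact .seqRet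
  | seqStep _ ih => exact .seqStep ih
  | parRet => exact .parRet
  | parL _ ih => exact .parL ih
  | parR _ ih => exact .parR ih
  | morphRet => exact .morphRet
  | morphStep _ ih => exact .morphStep ih

/-- Reduces preservation of the state space and of the other component to the corresponding laws for
transitions. -/
theorem eq_or_intTr {V W : Resource.{u}} {A : Type v} {Δ : MCtx.{u, w} V W} {xs xs₁ : Δ.Idx}
    {s s₁ : W.St} {T T₁ : ActionTree.{u, v, w} V A} {π : TreePath}
    (h : Step Δ xs s T π xs₁ s₁ T₁) : s = s₁ ∨ ∃ q : W.IntTr, q.1 s s₁ := by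
  induction h with
  | act h => exact .inr ⟨_, MCtx.apply_of_unwind h⟩
  | seqRet | parRet | morphRet => exact .inl rfl
  | seqStep _ ih | parL _ ih | parR _ ih | morphStep _ ih => exact ih

theorem not_ret {V W : Resource.{u}} {A : Type v} {Δ : MCtx.{u, w} V W} {xs xs₁ : Δ.Idx}
    {s s₁ : W.St} {r : A} {T₁ : ActionTree.{u, v, w} V A} {π : TreePath} :
    ¬ Step Δ xs s (.ret r) π xs₁ s₁ T₁ := by
  intro h; cases h

theorem local_frame {V W : Resource.{u}} {A : Type v} {Δ : MCtx.{u, w} V W} {xs xs₁ : Δ.Idx}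
    {s s₁ : W.St} {p : W.U} {T T₁ : ActionTree.{u, v, w} V A} {π : TreePath}
    (h : Step Δ xs (s.otherFrame p) T π xs₁ s₁ T₁) :
    ∃ s₂ : W.St, s₁ = s₂.otherFrame p ∧ Step Δ xs (s.selfFrame p) T π xs₁ (s₂.selfFrame p) T₁ := by
  generalize hs : s.otherFrame p = t at h
  induction h with
  | act h =>
    subst hs
    obtain ⟨s₂, rfl, h₂⟩ := MCtx.unwind_local h
    exact ⟨s₂, rfl, .act h₂⟩
  | seqRet => exact ⟨s, hs.symm, .seqRet⟩
  | parRet => exact ⟨s, hs.symm, .parRet⟩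
  | morphRet => exact ⟨s, hs.symm, .morphRet⟩
  | seqStep _ ih => obtain ⟨s₂, h₁, h₂⟩ := ih hs; exact ⟨s₂, h₁, .seqStep h₂⟩
  | parL _ ih => obtain ⟨s₂, h₁, h₂⟩ := ih hs; exact ⟨s₂, h₁, .parL h₂⟩
  | parR _ ih => obtain ⟨s₂, h₁, h₂⟩ := ih hs; exact ⟨s₂, h₁, .parR h₂⟩
  | morphStep _ ih => obtain ⟨s₂, h₁, h₂⟩ := ih hs; exact ⟨s₂, h₁, .morphStep h₂⟩

theorem functional {V W : Resource.{u}} {A : Type v} {Δ : MCtx.{u, w} V W} {xs ys zs : Δ.Idx}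
    {s s₁ s₂ : W.St} {T T₁ T₂ : ActionTree.{u, v, w} V A} {π : TreePath}
    (h₁ : Step Δ xs s T π ys s₁ T₁) (h₂ : Step Δ xs s T π zs s₂ T₂) :
    ys = zs ∧ s₁ = s₂ ∧ T₁ = T₂ := by
  induction h₁ with
  | act h =>
    cases h₂ with
    | act h' => obtain ⟨rfl, rfl, rfl⟩ := MCtx.unwind_functional h h'; exact ⟨rfl, rfl, rfl⟩
  | seqRet => cases h₂; exact ⟨rfl, rfl, rfl⟩
  | parRet => cases h₂; exact ⟨rfl, rfl, rfl⟩
  | morphRet => cases h₂; exact ⟨rfl, rfl, rfl⟩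
  | seqStep _ ih =>
    cases h₂ with
    | seqStep h' => obtain ⟨rfl, rfl, rfl⟩ := ih h'; exact ⟨rfl, rfl, rfl⟩
  | parL _ ih =>
    cases h₂ with
    | parL h' => obtain ⟨rfl, rfl, rfl⟩ := ih h'; exact ⟨rfl, rfl, rfl⟩
  | parR _ ih =>
    cases h₂ with
    | parR h' => obtain ⟨rfl, rfl, rfl⟩ := ih h'; exact ⟨rfl, rfl, rfl⟩
  | morphStep _ ih =>
    cases h₂ with
    | morphStep h' =>
      obtain ⟨h₁, rfl, rfl⟩ := ih h'
      obtain ⟨rfl, rfl⟩ := MCtx.snocIdx_injective _ _ h₁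
      exact ⟨rfl, rfl, rfl⟩

/-- A step in a context can be simulated under one more family. -/
theorem cons {V W Z : Resource.{u}} {A : Type v} {X : Type w} {Δ : MCtx.{u, w} V W}
    {xs xs₁ : Δ.Idx} {r r₁ : W.St} {T T₁ : ActionTree.{u, v, w} V A} {π : TreePath}
    (h : Step Δ xs r T π xs₁ r₁ T₁) (f : Family X W Z) {x : X} {s : Z.St} (hr : f.rel x r s) :
    ∃ x₁ s₁, f.rel x₁ r₁ s₁ ∧ Step (.cons f Δ) (x, xs) s T π (x₁, xs₁) s₁ T₁ := by
  induction h with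
  | act h =>
    obtain ⟨x₁, s₁, h₁, h₂⟩ := f.sim_internal _ _ _ _ _ (MCtx.apply_of_unwind h) hr
    exact ⟨x₁, s₁, h₂, .act ⟨h₁, _, _, hr, h, h₂⟩⟩
  | seqRet => exact ⟨x, s, hr, .seqRet⟩
  | parRet => exact ⟨x, s, hr, .parRet⟩
  | morphRet => exact ⟨x, s, hr, .morphRet⟩
  | seqStep _ ih => obtain ⟨x₁, s₁, h₁, h₂⟩ := ih f hr; exact ⟨x₁, s₁, h₁, .seqStep h₂⟩
  | parL _ ih => obtain ⟨x₁, s₁, h₁, h₂⟩ := ih f hr; exact ⟨x₁, s₁, h₁, .parL h₂⟩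
  | parR _ ih => obtain ⟨x₁, s₁, h₁, h₂⟩ := ih f hr; exact ⟨x₁, s₁, h₁, .parR h₂⟩
  -- Extending a context outside and inside commute by computation, which is why the statement
  -- covers every `Δ`.
  | morphStep _ ih => obtain ⟨x₁, s₁, h₁, h₂⟩ := ih f hr; exact ⟨x₁, s₁, h₁, .morphStep h₂⟩

/-- A step under a family comes from a step without it. -/
theorem of_cons {V W Z : Resource.{u}} {A : Type v} {X : Type w} {Δ : MCtx.{u, w} V W}
    {xs xs₁ : Δ.Idx} {T T₁ : ActionTree.{u, v, w} V A} {π : TreePath} {f : Family X W Z}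
    {x x₁ : X} {s s₁ : Z.St} {r : W.St} (hr : f.rel x r s)
    (h : Step (.cons f Δ) (x, xs) s T π (x₁, xs₁) s₁ T₁) :
    f.FSteps (x, s) (x₁, s₁) ∧ ∃ r₁, f.rel x₁ r₁ s₁ ∧ Step Δ xs r T π xs₁ r₁ T₁ := by
  -- The induction is on the tree, since the context `.cons f Δ` of the step is not a variable.
  induction T generalizing W Z X π with
  | unfinished => cases h
  | ret => cases h
  | act a =>
    cases h with
    | act h =>
      obtain ⟨h₁, r', r₁, hr', hu, hr₁⟩ := h
      obtain rfl := f.functional _ _ _ _ hr hr'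
      exact ⟨.single (.inl ⟨_, _, _, hr, hr₁, MCtx.apply_of_unwind hu, h₁⟩), r₁, hr₁, .act hu⟩
  | seq T K ih =>
    cases h with
    | seqRet => exact ⟨.refl, r, hr, .seqRet⟩
    | seqStep h => obtain ⟨h₁, r₁, h₂, h₃⟩ := ih hr h; exact ⟨h₁, r₁, h₂, .seqStep h₃⟩
  | par T₁ T₂ K ih₁ ih₂ =>
    cases h with
    | parRet => exact ⟨.refl, r, hr, .parRet⟩
    | parL h => obtain ⟨h₁, r₁, h₂, h₃⟩ := ih₁ hr h; exact ⟨h₁, r₁, h₂, .parL h₃⟩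
    | parR h => obtain ⟨h₁, r₁, h₂, h₃⟩ := ih₂ hr h; exact ⟨h₁, r₁, h₂, .parR h₃⟩
  | morph y g T ih =>
    cases h with
    | morphRet => exact ⟨.refl, r, hr, .morphRet⟩
    | morphStep h => obtain ⟨h₁, r₁, h₂, h₃⟩ := ih hr h; exact ⟨h₁, r₁, h₂, .morphStep h₃⟩

end Step

/-! ### The modality `always` -/

section Transformers

variable {V W : Resource.{u}} {A B : Type v}

theorem Step₀.preserves {T T₁ : ActionTree.{u, v, w} V A} {π : TreePath} {s s₁ : V.St}
    (h : Step₀ s T π s₁ T₁) (hs : V.S s) : V.S s₁ := by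
  obtain rfl | ⟨q, hq⟩ := Step.eq_or_intTr h
  · exact hs
  · exact q.isTransition.preserves _ _ hq hs

theorem alwaysAlong_of_oSteps {X : V.St → ActionTree.{u, v, w} V A → Prop}
    {T : ActionTree.{u, v, w} V A} {s s₁ : V.St} {ζ : List TreePath}
    (h : alwaysAlong X ζ T s) (hs : V.OSteps s s₁) : alwaysAlong X ζ T s₁ := by
  cases ζ with
  | nil => exact fun s₂ h₂ => h s₂ (hs.trans h₂)
  | cons π ζ => exact fun s₂ h₂ => h s₂ (hs.trans h₂)

section Always

variable {X : V.St → ActionTree.{u, v, w} V A → Prop} {T T₁ : ActionTree.{u, v, w} V A}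
  {π : TreePath} {s s₁ : V.St}

theorem always_of_oSteps (h : always T X s) (hs : V.OSteps s s₁) : always T X s₁ :=
  fun ζ => alwaysAlong_of_oSteps (h ζ) hs

/-- With `always_of_oSteps`, the next three facts say that `always` is itself an invariant, so it
can be used inside other invariants. -/
theorem always_self (h : always T X s) : X s T := h [] s .refl

theorem always_safe (h : always T X s) : Safe T π s := (h [π] s .refl).1

theorem always_step (h : always T X s) (hs : Step₀ s T π s₁ T₁) : always T₁ X s₁ :=
  fun ζ => (h (π :: ζ) s .refl).2.2 _ _ hs

/-- Coinduction principle for `always`. -/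
theorem always_of_invariant (R : V.St → ActionTree.{u, v, w} V A → Prop)
    (env : ∀ s T s₁, R s T → V.OSteps s s₁ → R s₁ T) (sound : ∀ s T, R s T → X s T)
    (safe : ∀ s T π, R s T → Safe T π s)
    (step : ∀ s T π s₁ T₁, R s T → Step₀ s T π s₁ T₁ → R s₁ T₁) (h : R s T) :
    always T X s := by
  intro ζ
  induction ζ generalizing s T with
  | nil => exact fun s₂ hs => sound _ _ (env _ _ _ h hs)
  | cons π ζ ih =>
    intro s₂ hs
    have h₂ := env _ _ _ h hs
    exact ⟨safe _ _ _ h₂, sound _ _ h₂, fun s₃ T₁ h₃ => ih (step _ _ _ _ _ h₂ h₃)⟩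

end Always

/-! ### Return, consequence and sequential composition. -/

theorem after_ret {Q : A → V.St → Prop} {r : A} {s : V.St} (h : V.stab (Q r) s) :
    after (.ret r : ActionTree.{u, v, w} V A) Q s := by
  refine always_of_invariant (fun s T => T = .ret r ∧ V.stab (Q r) s) ?_ ?_ ?_ ?_ ⟨rfl, h⟩
  · rintro s T s₁ ⟨rfl, h⟩ hs
    exact ⟨rfl, Resource.stab_of_oSteps h hs⟩
  · rintro s T ⟨rfl, h⟩ r' hr
    cases hr
    exact h s .refl
  · rintro s T π ⟨rfl, h⟩ hg
    cases hg
  · rintro s T π s₁ T₁ ⟨rfl, h⟩ hs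
    exact (Step.not_ret hs).elim

theorem stab_of_after_ret {Q : A → V.St → Prop} {r : A} {s : V.St}
    (h : after (.ret r : ActionTree.{u, v, w} V A) Q s) : V.stab (Q r) s :=
  fun _ hs => always_self (always_of_oSteps h hs) r rfl

theorem after_unfinished {Q : A → V.St → Prop} {s : V.St} :
    after (.unfinished : ActionTree.{u, v, w} V A) Q s := by
  refine always_of_invariant (fun _ T => T = .unfinished) ?_ ?_ ?_ ?_ rfl
  · exact fun _ _ _ h _ => h
  · rintro s T rfl r hr
    cases hr
  · rintro s T π rfl hg
    cases hg
  · rintro s T π s₁ T₁ rfl hs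
    cases hs

theorem vrf_post {e : Prog.{u, v, w} V A} {Q₁ Q₂ : A → V.St → Prop}
    (h : ∀ r s, V.S s → Q₁ r s → Q₂ r s) {s : V.St} (hs : vrf e Q₁ s) : vrf e Q₂ s := by
  refine ⟨hs.1, fun T hT => ?_⟩
  -- The implication is assumed only on `V.S`, so membership in the state space has to be carried
  -- along.
  refine always_of_invariant (fun s T => V.S s ∧ after T Q₁ s) ?_ ?_ ?_ ?_ ⟨hs.1, hs.2 T hT⟩
  · exact fun s T s₁ h hs => ⟨hs.preserves h.1, always_of_oSteps h.2 hs⟩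
  · exact fun s T h₁ r hr => h _ _ h₁.1 (always_self h₁.2 r hr)
  · exact fun s T π h => always_safe h.2
  · exact fun s T π s₁ T₁ h hs => ⟨hs.preserves h.1, always_step h.2 hs⟩

theorem vrf_ret {Q : A → V.St → Prop} {r : A} {s : V.St} (hs : V.S s) (h : V.stab (Q r) s) :
    vrf (Prog.ret.{u, v, w} r) Q s := by
  refine ⟨hs, ?_⟩
  rintro T (rfl | rfl)
  · exact after_unfinished
  · exact after_ret h

theorem after_seq {T : ActionTree.{u, v, w} V B} {K : B → ActionTree.{u, v, w} V A}
    {Q : A → V.St → Prop} {s : V.St} (h : after T (fun r => after (K r) Q) s) :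
    after (.seq T K) Q s := by
  -- Either the first tree is still running, or control has passed to a continuation and `after` is
  -- its own invariant.
  refine always_of_invariant (fun s T₀ => (∃ T, T₀ = .seq T K ∧ after T (fun r => after (K r) Q) s) ∨
    after T₀ Q s) ?_ ?_ ?_ ?_ (.inl ⟨T, rfl, h⟩)
  · rintro s _ s₁ (⟨T, rfl, h⟩ | h) hs
    · exact .inl ⟨T, rfl, always_of_oSteps h hs⟩
    · exact .inr (always_of_oSteps h hs)
  · rintro s _ (⟨T, rfl, h⟩ | h) r hr
    · cases hr
    · exact always_self h r hr
  · rintro s _ π (⟨T, rfl, h⟩ | h)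
    · intro hg
      cases hg with
      | seqRet => exact ⟨_, _, .seqRet⟩
      | seqStep hg =>
        obtain ⟨s₁, T₁, h₁⟩ := always_safe h hg
        exact ⟨_, _, .seqStep h₁⟩
    · exact always_safe h
  · rintro s _ π s₁ T₁ (⟨T, rfl, h⟩ | h) hs
    · cases hs with
      | seqRet => exact .inr (always_self h _ rfl)
      | seqStep hs => exact .inl ⟨_, rfl, always_step h hs⟩
    · exact .inr (always_step h hs)

theorem after_mono {T : ActionTree.{u, v, w} V A} {Q₁ Q₂ : A → V.St → Prop}
    (h : ∀ r s, Q₁ r s → Q₂ r s) {s : V.St} (hs : after T Q₁ s) : after T Q₂ s :=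
  always_of_invariant (fun s T => after T Q₁ s) (fun _ _ _ => always_of_oSteps)
    (fun _ _ h₁ r hr => h _ _ (always_self h₁ r hr)) (fun _ _ _ => always_safe)
    (fun _ _ _ _ _ => always_step) hs

theorem vrf_bnd {e₁ : Prog.{u, v, w} V B} {e₂ : B → Prog.{u, v, w} V A} {Q : A → V.St → Prop}
    {s : V.St} (h : vrf e₁ (fun x => vrf (e₂ x) Q) s) : vrf (Prog.bnd e₁ e₂) Q s := by
  refine ⟨h.1, ?_⟩
  rintro T (rfl | ⟨T₁, K, rfl, hT, hK⟩)
  · exact after_unfinished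
  · exact after_seq (after_mono (fun r s h => h.2 _ (hK r)) (h.2 _ hT))

/-! ### Framing and parallel composition. -/

/-- The steps of a tree in a framed state are those of the tree in the unframed state, where the
frame belongs to the environment; for the frame they are interference. -/
theorem step_star {X : V.St → ActionTree.{u, v, w} V A → Prop} {T T₁ : ActionTree.{u, v, w} V A}
    {π : TreePath} {x₁ x₂ o : V.U} {j : V.T} {s₁ : V.St} (h : always T X ⟨x₁, j, join o x₂⟩)
    (hs : Step₀ ⟨join x₁ x₂, j, o⟩ T π s₁ T₁) :
    ∃ y₁ j₁, s₁ = ⟨join y₁ x₂, j₁, o⟩ ∧ always T₁ X ⟨y₁, j₁, join o x₂⟩ ∧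
      V.OSteps ⟨x₂, j, join o x₁⟩ ⟨x₂, j₁, join o y₁⟩ := by
  -- Safety supplies a step of the part; locality carries it to the whole, where determinism
  -- identifies it with `hs`.
  obtain ⟨t, T', ht⟩ := always_safe h (Step.good hs)
  have ht' : Step₀ (State.otherFrame ⟨x₁, j, o⟩ x₂) T π t T' := by
    simpa [State.otherFrame, PCM.join_comm x₂ o] using ht
  obtain ⟨⟨y₁, j₁, o₁⟩, rfl, h₂⟩ := Step.local_frame ht'
  obtain ⟨-, h₃, rfl⟩ := Step.functional h₂ hs
  subst h₃
  have ho : o = o₁ := by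
    obtain h | ⟨q, hq⟩ := Step.eq_or_intTr h₂
    · exact congrArg State.other h
    · exact q.isTransition.other_fixed _ _ hq
  subst ho
  have he : State.otherFrame ⟨y₁, j₁, o⟩ x₂ = (⟨y₁, j₁, join o x₂⟩ : V.St) := by
    simp [State.otherFrame, PCM.join_comm]
  rw [he] at ht
  refine ⟨y₁, j₁, rfl, always_step h ht, ?_⟩
  obtain h | ⟨q, hq⟩ := Step.eq_or_intTr ht
  · simp only [State.mk.injEq] at h
    obtain ⟨rfl, rfl, -⟩ := h
    exact .refl
  · exact .single (q.oStep hq)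

theorem safe_star {X : V.St → ActionTree.{u, v, w} V A → Prop} {T : ActionTree.{u, v, w} V A}
    {π : TreePath} {x₁ x₂ o : V.U} {j : V.T} (h : always T X ⟨x₁, j, join o x₂⟩) :
    Safe T π ⟨join x₁ x₂, j, o⟩ := by
  intro hg
  obtain ⟨t, T', ht⟩ := always_safe h hg
  have ht' : Step₀ (State.otherFrame ⟨x₁, j, o⟩ x₂) T π t T' := by
    simpa [State.otherFrame, PCM.join_comm x₂ o] using ht
  obtain ⟨t₂, -, h₂⟩ := Step.local_frame ht'
  exact ⟨_, _, h₂⟩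

theorem star_stab {Q₁ Q₂ : V.St → Prop} {s : V.St} (h : V.star (V.stab Q₁) (V.stab Q₂) s) :
    V.stab (V.star Q₁ Q₂) s := by
  obtain ⟨a, j, o⟩ := s
  obtain ⟨x₁, x₂, rfl : a = _, h₁, h₂⟩ := h
  intro s₁ hs
  obtain ⟨j₁, o₁, rfl, h₃, h₄⟩ := hs.star
  exact ⟨x₁, x₂, rfl, h₁ _ h₃, h₂ _ h₄⟩

theorem after_par {A₁ A₂ : Type v} {T₁ : ActionTree.{u, v, w} V A₁}
    {T₂ : ActionTree.{u, v, w} V A₂} {Q₁ : A₁ → V.St → Prop} {Q₂ : A₂ → V.St → Prop} {s : V.St}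
    (h : V.star (after T₁ Q₁) (after T₂ Q₂) s) :
    after (.par T₁ T₂ .ret) (fun r => V.star (Q₁ r.1) (Q₂ r.2)) s := by
  refine always_of_invariant (fun s T => (∃ T₁ T₂, T = .par T₁ T₂ .ret ∧
    V.star (after T₁ Q₁) (after T₂ Q₂) s) ∨ after T (fun r => V.star (Q₁ r.1) (Q₂ r.2)) s)
    ?_ ?_ ?_ ?_ (.inl ⟨T₁, T₂, rfl, h⟩)
  · rintro ⟨a, j, o⟩ _ s₁ (⟨T₁, T₂, rfl, x₁, x₂, rfl : a = _, h₁, h₂⟩ | h) hs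
    · obtain ⟨j₁, o₁, rfl, h₃, h₄⟩ := hs.star
      exact .inl ⟨T₁, T₂, rfl, x₁, x₂, rfl, always_of_oSteps h₁ h₃, always_of_oSteps h₂ h₄⟩
    · exact .inr (always_of_oSteps h hs)
  · rintro s _ (⟨T₁, T₂, rfl, h⟩ | h) r hr
    · cases hr
    · exact always_self h r hr
  · rintro ⟨a, j, o⟩ _ π (⟨T₁, T₂, rfl, x₁, x₂, rfl : a = _, h₁, h₂⟩ | h)
    · intro hg
      cases hg with
      | parRet => exact ⟨_, _, .parRet⟩
      | parL hg =>
        obtain ⟨_, _, h₃⟩ := safe_star h₁ hg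
        exact ⟨_, _, .parL h₃⟩
      | parR hg =>
        obtain ⟨_, _, h₃⟩ := safe_star h₂ hg
        rw [PCM.join_comm] at h₃
        exact ⟨_, _, .parR h₃⟩
    · exact always_safe h
  · rintro ⟨a, j, o⟩ _ π s₁ T (⟨T₁, T₂, rfl, x₁, x₂, rfl : a = _, h₁, h₂⟩ | h) hs
    · cases hs with
      | parRet =>
        -- Verified results are stable on each side, and interference on the whole splits, so their
        -- conjunction is stable too.
        exact .inr (after_ret (star_stab ⟨x₁, x₂, rfl, stab_of_after_ret h₁, stab_of_after_ret h₂⟩))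
      | parL hs =>
        obtain ⟨y₁, j₁, rfl, h₃, h₄⟩ := step_star h₁ hs
        exact .inl ⟨_, _, rfl, y₁, x₂, rfl, h₃, always_of_oSteps h₂ h₄⟩
      | parR hs =>
        rw [PCM.join_comm] at hs
        obtain ⟨y₂, j₁, rfl, h₃, h₄⟩ := step_star h₂ hs
        exact .inl ⟨_, _, rfl, x₁, y₂, PCM.join_comm _ _, always_of_oSteps h₁ h₄, h₃⟩
    · exact .inr (always_step h hs)

/-- The frame acts as an idle thread, to which every step of `T` is interference; stabilizing `Q₂`
absorbs it. -/
theorem after_frame {T : ActionTree.{u, v, w} V A} {Q₁ : A → V.St → Prop} {Q₂ : V.St → Prop}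
    {s : V.St} (h : V.star (after T Q₁) (V.stab Q₂) s) :
    after T (fun r => V.star (Q₁ r) Q₂) s := by
  refine always_of_invariant (fun s T => V.star (after T Q₁) (V.stab Q₂) s) ?_ ?_ ?_ ?_ h
  · rintro ⟨a, j, o⟩ T s₁ ⟨x₁, x₂, rfl : a = _, h₁, h₂⟩ hs
    obtain ⟨j₁, o₁, rfl, h₃, h₄⟩ := hs.star
    exact ⟨x₁, x₂, rfl, always_of_oSteps h₁ h₃, Resource.stab_of_oSteps h₂ h₄⟩
  · rintro s T ⟨x₁, x₂, hx, h₁, h₂⟩ r hr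
    exact ⟨x₁, x₂, hx, always_self h₁ r hr, h₂ _ .refl⟩
  · rintro ⟨a, j, o⟩ T π ⟨x₁, x₂, rfl : a = _, h₁, h₂⟩
    exact safe_star h₁
  · rintro ⟨a, j, o⟩ T π s₁ T₁ ⟨x₁, x₂, rfl : a = _, h₁, h₂⟩ hs
    obtain ⟨y₁, j₁, rfl, h₃, h₄⟩ := step_star h₁ hs
    exact ⟨y₁, x₂, rfl, h₃, Resource.stab_of_oSteps h₂ h₄⟩

theorem vrf_par {A₁ A₂ : Type v} {e₁ : Prog.{u, v, w} V A₁} {e₂ : Prog.{u, v, w} V A₂}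
    {Q₁ : A₁ → V.St → Prop} {Q₂ : A₂ → V.St → Prop} {s : V.St}
    (h : V.star (vrf e₁ Q₁) (vrf e₂ Q₂) s) :
    vrf (Prog.par e₁ e₂) (fun r => V.star (Q₁ r.1) (Q₂ r.2)) s := by
  obtain ⟨a, j, o⟩ := s
  obtain ⟨x₁, x₂, rfl : a = _, h₁, h₂⟩ := h
  refine ⟨Resource.S_selfFrame h₁.1, ?_⟩
  rintro T (rfl | ⟨T₁, T₂, rfl, hT₁, hT₂⟩)
  · exact after_unfinished
  · exact after_par ⟨x₁, x₂, rfl, h₁.2 _ hT₁, h₂.2 _ hT₂⟩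

theorem vrf_frame {e : Prog.{u, v, w} V A} {Q₁ : A → V.St → Prop} {Q₂ : V.St → Prop} {s : V.St}
    (h : V.star (vrf e Q₁) (V.stab Q₂) s) : vrf e (fun r => V.star (Q₁ r) Q₂) s := by
  obtain ⟨a, j, o⟩ := s
  obtain ⟨x₁, x₂, rfl : a = _, h₁, h₂⟩ := h
  exact ⟨Resource.S_selfFrame h₁.1, fun T hT => after_frame ⟨x₁, x₂, rfl, h₁.2 _ hT, h₂⟩⟩

/-! ### Atomic actions. -/

theorem after_act {a : AtomicAction V A} {Q : A → V.St → Prop} {s : V.St}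
    (h : V.stab (fun s₁ => ∃ r s₂, a.rel r s₁ s₂ ∧ V.stab (Q r) s₂) s) :
    after (.act a : ActionTree.{u, v, w} V A) Q s := by
  refine always_of_invariant (fun s T => (T = .act a ∧
    V.stab (fun s₁ => ∃ r s₂, a.rel r s₁ s₂ ∧ V.stab (Q r) s₂) s) ∨ after T Q s)
    ?_ ?_ ?_ ?_ (.inl ⟨rfl, h⟩)
  · rintro s _ s₁ (⟨rfl, h⟩ | h) hs
    · exact .inl ⟨rfl, Resource.stab_of_oSteps h hs⟩
    · exact .inr (always_of_oSteps h hs)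
  · rintro s _ (⟨rfl, h⟩ | h) r hr
    · cases hr
    · exact always_self h r hr
  · rintro s _ π (⟨rfl, h⟩ | h)
    · intro hg
      cases hg
      obtain ⟨r, s₂, h₁, -⟩ := h s .refl
      exact ⟨s₂, .ret r, .act h₁⟩
    · exact always_safe h
  · rintro s _ π s₁ T₁ (⟨rfl, h⟩ | h) hs
    · cases hs with
      | act hs =>
        obtain ⟨r, s₂, h₁, h₂⟩ := h s .refl
        change a.rel _ _ _ at hs
        obtain rfl := a.functional _ _ _ _ _ h₁ hs
        obtain rfl := (a.tr r).isTransition.functional _ _ _ h₁ hs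
        exact .inr (after_ret h₂)
    · exact .inr (always_step h hs)

theorem vrf_atomic {a : AtomicAction V A} {Q : A → V.St → Prop} {s : V.St} (hs : V.S s)
    (h : V.stab (fun s₁ => ∃ r s₂, a.rel r s₁ s₂ ∧ V.stab (Q r) s₂) s) :
    vrf (Prog.atomic.{u, v, w} a) Q s := by
  refine ⟨hs, ?_⟩
  rintro T (rfl | rfl)
  · exact after_unfinished
  · exact after_act h

/-! ### Morphisms -/

theorem Family.fSteps_of_oSteps {X : Type w} (f : Family X V W) (x : X) {s s₁ : W.St}
    (h : W.OSteps s s₁) : f.FSteps (x, s) (x, s₁) := by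
  induction h with
  | refl => exact .refl
  | tail _ h ih => exact ih.tail (.inr ⟨rfl, h⟩)

theorem Family.fstab_of_fSteps {X : Type w} {f : Family X V W} {I : X → W.St → Prop} {x x₁ : X}
    {s s₁ : W.St} (h : f.fstab I x s) (hs : f.FSteps (x, s) (x₁, s₁)) : f.fstab I x₁ s₁ :=
  fun _ _ h₂ => h _ _ (hs.trans h₂)

theorem after_morph {X : Type w} {f : Family X V W} {x : X} {T : ActionTree.{u, v, w} V A}
    {Q : A → V.St → Prop} {I : X → W.St → Prop} {s : W.St}
    (h : f.image x (after T Q) s) (hI : f.fstab I x s) :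
    after (.morph x f T) (fun r s₁ => ∃ y, f.image y (Q r) s₁ ∧ I y s₁) s := by
  -- The index is existential because steps of the inner tree may change it; interference keeps it.
  refine always_of_invariant (fun s T₀ => (∃ x T, T₀ = .morph x f T ∧
    f.image x (after T Q) s ∧ f.fstab I x s) ∨
    after T₀ (fun r s₁ => ∃ y, f.image y (Q r) s₁ ∧ I y s₁) s) ?_ ?_ ?_ ?_ (.inl ⟨x, T, rfl, h, hI⟩)
  · rintro s _ s₁ (⟨x, T, rfl, ⟨r, hr, h⟩, hI⟩ | h) hs
    · obtain ⟨r₁, h₁, h₂⟩ := f.sim_other _ _ _ _ hs hr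
      exact .inl ⟨x, T, rfl, ⟨r₁, h₂, always_of_oSteps h h₁⟩,
        Family.fstab_of_fSteps hI (f.fSteps_of_oSteps x hs)⟩
    · exact .inr (always_of_oSteps h hs)
  · rintro s _ (⟨x, T, rfl, -⟩ | h) r hr
    · cases hr
    · exact always_self h r hr
  · rintro s _ π (⟨x, T, rfl, ⟨r, hr, h⟩, hI⟩ | h)
    · intro hg
      cases hg with
      | morphRet => exact ⟨_, _, .morphRet⟩
      | morphStep hg =>
        obtain ⟨r₁, T₁, h₁⟩ := always_safe h hg
        obtain ⟨x₁, s₁, -, h₂⟩ := Step.cons h₁ f hr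
        -- `nil.snoc f` computes to `cons f nil`, so the simulated step is a premise of `morphStep`.
        exact ⟨s₁, .morph x₁ f T₁, .morphStep h₂⟩
    · exact always_safe h
  · rintro s _ π s₁ T₁ (⟨x, T, rfl, ⟨r, hr, h⟩, hI⟩ | h) hs
    · cases hs with
      | morphRet =>
        refine .inr (after_ret fun s₁ hs => ?_)
        obtain ⟨r₁, h₁, h₂⟩ := f.sim_other _ _ _ _ hs hr
        exact ⟨x, ⟨r₁, h₂, stab_of_after_ret h _ h₁⟩, hI _ _ (f.fSteps_of_oSteps x hs)⟩
      | morphStep hs =>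
        obtain ⟨h₁, r₁, h₂, h₃⟩ := Step.of_cons hr hs
        exact .inl ⟨_, _, rfl, ⟨r₁, h₂, always_step h h₃⟩, Family.fstab_of_fSteps hI h₁⟩
    · exact .inr (always_step h hs)

theorem vrf_morphX {X : Type w} {f : Family X V W} {x : X} {e : Prog.{u, v, w} V A}
    {Q : A → V.St → Prop} {I : X → W.St → Prop} {s : W.St}
    (h : f.image x (vrf e Q) s) (hI : f.fstab I x s) :
    vrf (Prog.morphX x f e) (fun r s₁ => ∃ y, f.image y (Q r) s₁ ∧ I y s₁) s := by
  obtain ⟨r, hr, h⟩ := h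
  refine ⟨(f.rel_space _ _ _ hr).2, ?_⟩
  rintro T (rfl | ⟨T, hT, rfl⟩)
  · exact after_unfinished
  · exact after_morph ⟨r, hr, h.2 T hT⟩ hI

theorem Morphism.fSteps_of_toFamily {f : Morphism V W} {c c₁ : PUnit.{w + 1} × W.St}
    (h : f.toFamily.FSteps c c₁) : f.FSteps c.2 c₁.2 := by
  induction h with
  | refl => exact .refl
  | tail _ h ih => exact ih.tail (h.imp id And.right)

theorem vrf_morph {f : Morphism V W} {e : Prog.{u, v, w} V A} {Q : A → V.St → Prop}
    {I : W.St → Prop} {s : W.St} (h : f.image (vrf e Q) s) (hI : f.fstab I s) :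
    vrf (Prog.morph f e) (fun r s₁ => f.image (Q r) s₁ ∧ I s₁) s := by
  refine vrf_post ?_ (vrf_morphX (f := f.toFamily) (x := PUnit.unit) (I := fun _ => I) h
    fun _ _ h => hI _ (Morphism.fSteps_of_toFamily h))
  rintro r s - ⟨_, h⟩
  exact h

/-! ### Lattices of programs -/

theorem vrf_bottom {Q : A → V.St → Prop} {s : V.St} (hs : V.S s) :
    vrf (Prog.bottom : Prog.{u, v, w} V A) Q s := by
  refine ⟨hs, ?_⟩
  rintro T rfl
  exact after_unfinished

theorem Prog.isBot_bottom : IsBot (Prog.bottom : Prog.{u, v, w} V A) := by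
  rintro e T rfl
  exact e.2

/-- The union of a set of programs, as a program. -/
def Prog.sup (M : Set (Prog.{u, v, w} V A)) : Prog.{u, v, w} V A :=
  ⟨{ActionTree.unfinished} ∪ {T | ∃ e ∈ M, T ∈ e.1}, Or.inl rfl⟩

theorem Prog.isLUB_sup (M : Set (Prog.{u, v, w} V A)) : IsLUB M (Prog.sup M) := by
  refine ⟨fun e he T hT => Or.inr ⟨e, he, hT⟩, ?_⟩
  rintro e he T (rfl | ⟨e', he', hT⟩)
  · exact e.2
  · exact he he' hT

/-- `V.S s` is assumed separately because `M` may be empty. -/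
theorem vrf_sup {M : Set (Prog.{u, v, w} V A)} {Q : A → V.St → Prop} {s : V.St} (hs : V.S s)
    (h : ∀ e ∈ M, vrf e Q s) : vrf (Prog.sup M) Q s := by
  refine ⟨hs, ?_⟩
  rintro T (rfl | ⟨e, he, hT⟩)
  · exact after_unfinished
  · exact (h e he).2 T hT

theorem Prog.isCompleteLatticeOrder : IsCompleteLatticeOrder (Prog.{u, v, w} V A) :=
  isCompleteLatticeOrder_of_isLUB fun M => ⟨_, Prog.isLUB_sup M⟩

theorem HoareType.isCompleteLatticeOrder {Γ : Type t} (P : Γ → V.St → Prop)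
    (Q : Γ → A → V.St → Prop) : IsCompleteLatticeOrder (HoareType.{u, v, w, t} P Q) := by
  refine isCompleteLatticeOrder_of_isLUB fun M => ?_
  have hT : Triple P Q (Prog.sup (Subtype.val '' M)) := by
    refine fun g s hs hP => vrf_sup hs ?_
    rintro _ ⟨e, -, rfl⟩
    exact e.2 g s hs hP
  refine ⟨⟨_, hT⟩, fun e he => (Prog.isLUB_sup _).1 ⟨e, he, rfl⟩, fun e he => ?_⟩
  refine (Prog.isLUB_sup (Subtype.val '' M)).2 ?_
  rintro _ ⟨e', he', rfl⟩
  exact he he'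

/-! ### Monotonicity -/

theorem Prog.bnd_monotone :
    Monotone (fun p : Prog.{u, v, w} V B × (B → Prog.{u, v, w} V A) => Prog.bnd p.1 p.2) := by
  rintro p p' h T (rfl | ⟨T₁, K, rfl, h₁, h₂⟩)
  · exact Or.inl rfl
  · exact Or.inr ⟨T₁, K, rfl, h.1 h₁, fun x => h.2 x (h₂ x)⟩

theorem Prog.par_monotone {A₁ A₂ : Type v} :
    Monotone (fun p : Prog.{u, v, w} V A₁ × Prog.{u, v, w} V A₂ => Prog.par p.1 p.2) := by
  rintro p p' h T (rfl | ⟨T₁, T₂, rfl, h₁, h₂⟩)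
  · exact Or.inl rfl
  · exact Or.inr ⟨T₁, T₂, rfl, h.1 h₁, h.2 h₂⟩

theorem Prog.morphX_monotone {X : Type w} (x : X) (f : Family X V W) :
    Monotone (fun e : Prog.{u, v, w} V A => Prog.morphX x f e) := by
  rintro e e' h T (rfl | ⟨T₁, h₁, rfl⟩)
  · exact Or.inl rfl
  · exact Or.inr ⟨T₁, h h₁, rfl⟩

end Transformers

end FCSL

/-! ### The soundness theorem. -/

theorem mainTheorem1 :
    -- vrf_vs
    (∀ (V : Resource.{u}) (A : Type v) (e : Prog.{u, v, w} V A) (Q : A → V.St → Prop) (s : V.St),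
      vrf e Q s → V.S s) ∧
    -- vrf_post
    (∀ (V : Resource.{u}) (A : Type v) (e : Prog.{u, v, w} V A) (Q₁ Q₂ : A → V.St → Prop),
      (∀ r s, V.S s → Q₁ r s → Q₂ r s) → ∀ s, vrf e Q₁ s → vrf e Q₂ s) ∧
    -- vrf_ret
    (∀ (V : Resource.{u}) (A : Type v) (r : A) (Q : A → V.St → Prop) (s : V.St),
      V.S s → V.stab (Q r) s → vrf (Prog.ret.{u, v, w} r) Q s) ∧
    -- vrf_bnd
    (∀ (V : Resource.{u}) (A B : Type v) (e₁ : Prog.{u, v, w} V B) (e₂ : B → Prog.{u, v, w} V A)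
      (Q : A → V.St → Prop) (s : V.St),
      vrf e₁ (fun x => vrf (e₂ x) Q) s → vrf (Prog.bnd e₁ e₂) Q s) ∧
    -- vrf_par
    (∀ (V : Resource.{u}) (A₁ A₂ : Type v) (e₁ : Prog.{u, v, w} V A₁) (e₂ : Prog.{u, v, w} V A₂)
      (Q₁ : A₁ → V.St → Prop) (Q₂ : A₂ → V.St → Prop) (s : V.St),
      V.star (vrf e₁ Q₁) (vrf e₂ Q₂) s →
        vrf (Prog.par e₁ e₂) (fun r => V.star (Q₁ r.1) (Q₂ r.2)) s) ∧
    -- vrf_frame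
    (∀ (V : Resource.{u}) (A : Type v) (e : Prog.{u, v, w} V A) (Q₁ : A → V.St → Prop)
      (Q₂ : V.St → Prop) (s : V.St),
      V.star (vrf e Q₁) (V.stab Q₂) s → vrf e (fun r => V.star (Q₁ r) Q₂) s) ∧
    -- vrf_atm
    (∀ (V : Resource.{u}) (A : Type v) (a : AtomicAction V A) (Q : A → V.St → Prop) (s : V.St),
      V.S s → V.stab (fun s₁ => ∃ r s₂, a.rel r s₁ s₂ ∧ V.stab (Q r) s₂) s →
        vrf (Prog.atomic.{u, v, w} a) Q s) ∧
    -- vrf_morph, for morphisms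
    (∀ (V W : Resource.{u}) (A : Type v) (f : Morphism V W) (e : Prog.{u, v, w} V A)
      (Q : A → V.St → Prop) (I : W.St → Prop) (s : W.St),
      f.image (vrf e Q) s ∧ f.fstab I s →
        vrf (Prog.morph f e) (fun r s₁ => f.image (Q r) s₁ ∧ I s₁) s) ∧
    -- vrf_morph, for indexed families
    (∀ (V W : Resource.{u}) (A : Type v) (X : Type w) (f : Family X V W) (x : X)
      (e : Prog.{u, v, w} V A) (Q : A → V.St → Prop) (I : X → W.St → Prop) (s : W.St),
      f.image x (vrf e Q) s ∧ f.fstab I x s →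
        vrf (Prog.morphX x f e) (fun r s₁ => ∃ y, f.image y (Q r) s₁ ∧ I y s₁) s) ∧
    -- the rule Lift
    (∀ (V W : Resource.{u}) (A : Type v) (Γ : Type t) (f : Morphism V W) (e : Prog.{u, v, w} V A)
      (P : Γ → V.St → Prop) (Q : Γ → A → V.St → Prop) (I : Γ → W.St → Prop),
      (∀ g, f.FStable (I g)) → Triple P Q e →
        Triple (fun g s => f.image (P g) s ∧ I g s)
          (fun g r s => f.image (Q g r) s ∧ I g s) (Prog.morph f e)) ∧
    -- the rule LiftX
    (∀ (V W : Resource.{u}) (A : Type v) (X : Type w) (Γ : Type t) (f : Family X V W) (x : X)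
      (e : Prog.{u, v, w} V A) (P : Γ → V.St → Prop) (Q : Γ → A → V.St → Prop)
      (I : Γ → X → W.St → Prop),
      (∀ g, f.FStable (I g)) → Triple P Q e →
        Triple (fun g s => f.image x (P g) s ∧ I g x s)
          (fun g r s => ∃ y, f.image y (Q g r) s ∧ I g y s) (Prog.morphX x f e)) ∧
    -- programs form a complete lattice with bottom element {unfinished}
    (∀ (V : Resource.{u}) (A : Type v),
      IsCompleteLatticeOrder (Prog.{u, v, w} V A) ∧
      IsBot (Prog.bottom : Prog.{u, v, w} V A) ∧
      HasLeastFixedPoints (Prog.{u, v, w} V A)) ∧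
    -- so do the Hoare triple types
    (∀ (V : Resource.{u}) (A : Type v) (Γ : Type t) (P : Γ → V.St → Prop)
      (Q : Γ → A → V.St → Prop),
      IsCompleteLatticeOrder (HoareType.{u, v, w, t} P Q) ∧
      (∃ h : Triple P Q (Prog.bottom : Prog.{u, v, w} V A),
        IsBot (⟨Prog.bottom, h⟩ : HoareType.{u, v, w, t} P Q)) ∧
      HasLeastFixedPoints (HoareType.{u, v, w, t} P Q)) ∧
    -- fixed points at dependent function types into Hoare triple types
    (∀ (V : Resource.{u}) (A : Type z) (B : A → Type v) (Γ : A → Type t)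
      (P : (x : A) → Γ x → V.St → Prop) (Q : (x : A) → Γ x → B x → V.St → Prop),
      HasLeastFixedPoints ((x : A) → HoareType.{u, v, w, t} (P x) (Q x))) ∧
    -- the program constructors are monotone
    (∀ (V : Resource.{u}) (A B : Type v),
      Monotone (fun p : Prog.{u, v, w} V B × (B → Prog.{u, v, w} V A) => Prog.bnd p.1 p.2)) ∧
    (∀ (V : Resource.{u}) (A₁ A₂ : Type v),
      Monotone (fun p : Prog.{u, v, w} V A₁ × Prog.{u, v, w} V A₂ => Prog.par p.1 p.2)) ∧
    (∀ (V W : Resource.{u}) (A : Type v) (X : Type w) (x : X) (f : Family X V W),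
      Monotone (fun e : Prog.{u, v, w} V A => Prog.morphX x f e)) ∧
    (∀ (V W : Resource.{u}) (A : Type v) (f : Morphism V W),
      Monotone (fun e : Prog.{u, v, w} V A => Prog.morph f e)) := by
  refine ⟨fun _ _ _ _ _ h => h.1, fun _ _ _ _ _ h _ => vrf_post h, fun _ _ _ _ _ => vrf_ret,
    fun _ _ _ _ _ _ _ => vrf_bnd, fun _ _ _ _ _ _ _ _ => vrf_par, fun _ _ _ _ _ _ => vrf_frame,
    fun _ _ _ _ _ => vrf_atomic, fun _ _ _ _ _ _ _ _ h => vrf_morph h.1 h.2,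
    fun _ _ _ _ _ _ _ _ _ _ h => vrf_morphX h.1 h.2, ?_, ?_,
    fun _ _ => ⟨Prog.isCompleteLatticeOrder, Prog.isBot_bottom,
      Prog.isCompleteLatticeOrder.hasLeastFixedPoints⟩,
    fun _ _ _ P Q => ⟨HoareType.isCompleteLatticeOrder P Q,
      ⟨fun _ _ hs _ => vrf_bottom hs, fun e => Prog.isBot_bottom e.1⟩,
      (HoareType.isCompleteLatticeOrder P Q).hasLeastFixedPoints⟩,
    fun _ _ _ _ P Q => hasLeastFixedPoints_pi fun x => HoareType.isCompleteLatticeOrder (P x) (Q x),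
    fun _ _ _ => Prog.bnd_monotone, fun _ _ _ => Prog.par_monotone,
    fun _ _ _ _ => Prog.morphX_monotone, fun _ _ _ f => Prog.morphX_monotone _ f.toFamily⟩
  · rintro V W A Γ f e P Q I hI he g s - ⟨⟨r, hr, hP⟩, hs⟩
    -- The triple is used at the inner state `r`, which lies in the state space because it is
    -- related to `s`.
    exact vrf_morph ⟨r, hr, he g r (f.rel_space _ _ hr).1 hP⟩ (hI g s hs)
  · rintro V W A X Γ f x e P Q I hI he g s - ⟨⟨r, hr, hP⟩, hs⟩
    exact vrf_morphX ⟨r, hr, he g r (f.rel_space _ _ _ hr).1 hP⟩ (hI g x s hs)
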